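/- Let $k\ge 1$. A (not necessarily normalized) state of $k$ qubits is given by its components $a=(a_I)_{I=(i_1,\dots,i_k)\in\{0,1\}^k}\in\mathbb C^{2^k}$; write $f(x)=\sum_I a_I x^{(1)}_{i_1}\cdots x^{(k)}_{i_k}$ for the associated multilinear form in auxiliary pairs of variables $x^{(j)}=(x^{(j)}_0,x^{(j)}_1)$. A tuple $g=(g^{(1)},\dots,g^{(k)})$ of invertible $2\times2$ complex matrices acts by $x'^{(j)}=g^{(j)}x^{(j)}$ and by $a\mapsto a'$ where $\sum_I a_I x^{(1)}_{i_1}\cdots x^{(k)}_{i_k}=\sum_I a'_I x'^{(1)}_{i_1}\cdots x'^{(k)}_{i_k}$. - An LSUT invariant is a polynomial $P(a,\bar a)$ with complex coefficients in the $a_I$ and $\bar a_I$ with $P(a',\bar a')=P(a,\bar a)$ for all $g\in SU(2)^k$; it has bidegree $(p,q)$ if it is homogeneous of degree $p$ in the $a_I$ and of degree $q$ in the $\bar a_I$. - A SLOCC invariant is a polynomial $P(a)$ with $P(a')=P(a)$ for all $g\in SL(2,\mathbb C)^k$. A SLOCC covariant of degree $n$ and multidegree $d=(d_1,\dots,d_k)$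 is a polynomial $\Phi(a,x)$, homogeneous of degree $n$ in $a$ and of degree $d_j$ in $x^{(j)}$ for every $j$, with $\Phi(a',x')=\Phi(a,x)$ for all $g\in SL(2,\mathbb C)^k$. - $\langle\Phi|\Psi\rangle$ denotes the hermitian scalar product of polynomials in the auxiliary variables, with the $a_I$ regarded as scalars, linear in $\Phi$ and antilinear in $\Psi$, for which distinct monomials are orthogonal and $\prod_{j,b}(x^{(j)}_b)^{m_{j,b}}$ has squared norm $\prod_{j,b} m_{j,b}!$; it is a polynomial in the $a_I$ and $\bar a_I$. - For $d\in\{0,2\}^k$ put $B_d=(f,f)^{\epsilon}$ with $\epsilon_j=(2-d_j)/2$, where $(\Psi,\Phi)^{\epsilon}$ is the transvectant obtained from $\Psi(x')\Phi(x'')$ by applying $\prod_j\Omega_j^{\epsilon_j}$, $\Omega_j=\frac{\partial}{\partial x'^{(j)}_0}\frac{\partial}{\partial x''^{(j)}_1}-\frac{\partial}{\partial x'^{(j)}_1}\frac{\partial}{\partial x''^{(j)}_0}$, and then setting $x'=x''=x$. Put $\mathbf B_d=\langle B_d|B_d\rangle$. Let $(C_i)$ be any basis of the space of SLOCC covariants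 of degree $3$ and multidegree $(1,\dots,1)$, let $(D_i)$ be any basis of the space of SLOCC invariants of degree $4$, and put $\mathbf C_i=\langle C_i|f\rangle$. **Proposition.** The space of LSUT invariants of total degree $4$ of $k$ qubits has dimension $\frac73 2^{k-1}-\frac43(-1)^{k-1}$, and it is the linear span of the polynomials $D_i$ (bidegree $(4,0)$), $\mathbf C_i$ (bidegree $(3,1)$), $\mathbf B_d$ for $d\in\{0,2\}^k$ with an even number of zero entries (bidegree $(2,2)$), $\overline{\mathbf C}_i$ (bidegree $(1,3)$) and $\overline{D}_i$ (bidegree $(0,4)$), each of which has the bidegree indicated. -/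

import Mathlib

noncomputable section

namespace Qubit

open MvPolynomial

/-- Multi-indices `(i_1, …, i_k)` with `i_j ∈ {0, 1}`, labelling the components `a_{i_1 … i_k}`
of a state of `k` qubits. -/
abbrev Idx (k : ℕ) : Type := Fin k → Fin 2

/-- Labels of the auxiliary variables: `(j, b)` labels the variable `x^{(j)}_b`. -/
abbrev Aux (k : ℕ) : Type := Fin k × Fin 2

/-- Holomorphic polynomials in the components `a_I` of the state. -/
abbrev HolPoly (k : ℕ) : Type := MvPolynomial (Idx k) ℂ

/-- Polynomials in the components `a_I` (`Sum.inl I`) and their conjugates (`Sum.inr I`). -/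
abbrev MixedPoly (k : ℕ) : Type := MvPolynomial (Idx k ⊕ Idx k) ℂ

/-- Polynomials in the components `a_I` and in the auxiliary variables `x^{(j)}_b`, written as
polynomials in the auxiliary variables with coefficients in `ℂ[a_I]`. -/
abbrev FormPoly (k : ℕ) : Type := MvPolynomial (Aux k) (HolPoly k)

/-! ### Group actions -/

/-- The action of a `k`-tuple of invertible matrices on the auxiliary variables,
`x'^{(j)} = g^{(j)} x^{(j)}`. -/
def actAux {k : ℕ} (g : Fin k → Matrix (Fin 2) (Fin 2) ℂ) (x : Aux k → ℂ) : Aux k → ℂ :=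
  fun p => ∑ b, g p.1 p.2 b * x (p.1, b)

/-- The action of a `k`-tuple of invertible matrices on the components of a multilinear form. It
is characterized by `∑ a_I x^{(1)}_{i_1} ⋯ x^{(k)}_{i_k} = ∑ a'_I x'^{(1)}_{i_1} ⋯ x'^{(k)}_{i_k}`,
see `sum_act_mul_actAux`. -/
def act {k : ℕ} (g : Fin k → Matrix (Fin 2) (Fin 2) ℂ) (a : Idx k → ℂ) : Idx k → ℂ :=
  fun I => ∑ J, (∏ j, (g j)⁻¹ (J j) (I j)) * a J

theorem sum_act_mul_actAux {k : ℕ} (g : Fin k → Matrix (Fin 2) (Fin 2) ℂ)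
    (hg : ∀ j, IsUnit (g j).det) (a : Idx k → ℂ) (x : Aux k → ℂ) :
    ∑ I, act g a I * ∏ j, actAux g x (j, I j) = ∑ I, a I * ∏ j, x (j, I j) := by
  have key : ∀ J : Idx k, ∑ I : Idx k, (∏ j, (g j)⁻¹ (J j) (I j)) * ∏ j, actAux g x (j, I j)
      = ∏ j, x (j, J j) := by
    intro J
    simp_rw [← Finset.prod_mul_distrib]
    rw [← Fintype.piFinset_univ,
      ← Finset.prod_univ_sum (fun _ => Finset.univ)
        (fun j b => (g j)⁻¹ (J j) b * actAux g x (j, b))]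
    refine Finset.prod_congr rfl fun j _ => ?_
    have h := congrFun (congrArg (fun M => Matrix.mulVec M (fun b => x (j, b)))
      (Matrix.nonsing_inv_mul (g j) (hg j))) (J j)
    simp only [← Matrix.mulVec_mulVec, Matrix.one_mulVec] at h
    rw [← h]
    rfl
  simp_rw [act, Finset.sum_mul]
  rw [Finset.sum_comm]
  refine Finset.sum_congr rfl fun J _ => ?_
  rw [← key J, Finset.mul_sum]
  exact Finset.sum_congr rfl fun I _ => by ring

/-! ### Invariants -/

/-- The value `I(a, ā)` of a polynomial in the components and their conjugates. -/
def evalConj {k : ℕ} (a : Idx k → ℂ) (P : MixedPoly k) : ℂ :=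
  eval (Sum.elim a fun I => starRingEnd ℂ (a I)) P

/-- The space of LSUT invariants of total degree `n`: polynomials in the components and their
conjugates, homogeneous of degree `n`, with `I(a, ā) = I(a', ā')` for all elements of
`SU(2)^k`. -/
def lsutInvariants (k n : ℕ) : Submodule ℂ (MixedPoly k) where
  carrier := {P | P.IsHomogeneous n ∧
    ∀ (g : Fin k → Matrix.specialUnitaryGroup (Fin 2) ℂ) (a : Idx k → ℂ),
      evalConj (act (fun j => (g j : Matrix (Fin 2) (Fin 2) ℂ)) a) P = evalConj a P}
  zero_mem' := ⟨isHomogeneous_zero _ _ _, fun g a => by simp [evalConj]⟩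
  add_mem' := fun {P Q} hP hQ => ⟨hP.1.add hQ.1, fun g a => by
    have h1 := hP.2 g a
    have h2 := hQ.2 g a
    simp only [evalConj, map_add] at h1 h2 ⊢
    rw [h1, h2]⟩
  smul_mem' := fun c P hP => ⟨(homogeneousSubmodule _ ℂ n).smul_mem c hP.1, fun g a => by
    have h1 := hP.2 g a
    simp only [evalConj, smul_eval] at h1 ⊢
    rw [h1]⟩

/-- The space of SLOCC invariants of degree `n`: holomorphic polynomials in the components,
homogeneous of degree `n`, with `I(a) = I(a')` for all elements of `SL(2, ℂ)^k`. -/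
def sloccInvariants (k n : ℕ) : Submodule ℂ (HolPoly k) where
  carrier := {P | P.IsHomogeneous n ∧
    ∀ (g : Fin k → Matrix.SpecialLinearGroup (Fin 2) ℂ) (a : Idx k → ℂ),
      eval (act (fun j => (g j : Matrix (Fin 2) (Fin 2) ℂ)) a) P = eval a P}
  zero_mem' := ⟨isHomogeneous_zero _ _ _, fun g a => by simp⟩
  add_mem' := fun {P Q} hP hQ => ⟨hP.1.add hQ.1, fun g a => by
    rw [map_add, map_add, hP.2 g a, hQ.2 g a]⟩
  smul_mem' := fun c P hP => ⟨(homogeneousSubmodule _ ℂ n).smul_mem c hP.1, fun g a => by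
    rw [smul_eval, smul_eval, hP.2 g a]⟩

/-! ### Covariants -/

/-- The weight of `x^{(j)}_b` is the `j`-th unit vector, so that the weighted degree is the
multidegree in the groups of variables `x^{(1)}, …, x^{(k)}`. -/
def auxWeight (k : ℕ) (p : Aux k) : Fin k → ℕ := Pi.single p.1 1

/-- The value `Φ(a, x)`. -/
def evalForm {k : ℕ} (a : Idx k → ℂ) (x : Aux k → ℂ) (Φ : FormPoly k) : ℂ :=
  eval x (map (eval a) Φ)

/-- The space of SLOCC covariants of degree `n` in the components `a_I` and of multidegree `d` in
the auxiliary variables: `Φ(a', x') = Φ(a, x)` for all elements of `SL(2, ℂ)^k`. -/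
def covariants (k n : ℕ) (d : Fin k → ℕ) : Submodule ℂ (FormPoly k) where
  carrier := {Φ | (∀ m, (coeff m Φ).IsHomogeneous n) ∧ IsWeightedHomogeneous (auxWeight k) Φ d ∧
    ∀ (g : Fin k → Matrix.SpecialLinearGroup (Fin 2) ℂ) (a : Idx k → ℂ) (x : Aux k → ℂ),
      evalForm (act (fun j => (g j : Matrix (Fin 2) (Fin 2) ℂ)) a)
        (actAux (fun j => (g j : Matrix (Fin 2) (Fin 2) ℂ)) x) Φ = evalForm a x Φ}
  zero_mem' := ⟨fun m => by rw [coeff_zero]; exact isHomogeneous_zero _ _ _,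
    isWeightedHomogeneous_zero _ _ _, fun g a x => by simp [evalForm]⟩
  add_mem' := fun {Φ Ψ} hΦ hΨ => ⟨fun m => by rw [coeff_add]; exact (hΦ.1 m).add (hΨ.1 m),
    hΦ.2.1.add hΨ.2.1, fun g a x => by
      have h1 := hΦ.2.2 g a x
      have h2 := hΨ.2.2 g a x
      simp only [evalForm, map_add] at h1 h2 ⊢
      rw [h1, h2]⟩
  smul_mem' := fun c Φ hΦ => by
    have hc : c • Φ = (C c : HolPoly k) • Φ := by
      rw [← algebraMap_eq, algebraMap_smul]
    refine ⟨fun m => ?_, ?_, fun g a x => ?_⟩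
    · rw [coeff_smul]
      exact (homogeneousSubmodule _ ℂ n).smul_mem c (hΦ.1 m)
    · rw [hc]
      exact (weightedHomogeneousSubmodule (HolPoly k) (auxWeight k) d).smul_mem _ hΦ.2.1
    · have h1 := hΦ.2.2 g a x
      simp only [evalForm, hc, smul_eq_C_mul, map_mul, map_C, eval_C] at h1 ⊢
      rw [h1]

/-- The ground form `f = ∑ a_{i_1 … i_k} x^{(1)}_{i_1} ⋯ x^{(k)}_{i_k}`. -/
def groundForm (k : ℕ) : FormPoly k :=
  ∑ I : Idx k, C (X I) * ∏ j, X (j, I j)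

/-- Polynomials in two copies `x'` (`Sum.inl`) and `x''` (`Sum.inr`) of the auxiliary variables. -/
abbrev DoubleForm (k : ℕ) : Type := MvPolynomial (Aux k ⊕ Aux k) (HolPoly k)

/-- The Cayley operator of the `j`-th group of variables,
`Ω = ∂/∂x'_0 ∂/∂x''_1 - ∂/∂x'_1 ∂/∂x''_0`. -/
def cayleyOmega {k : ℕ} (j : Fin k) : Module.End (HolPoly k) (DoubleForm k) :=
  (pderiv (Sum.inl (j, 0))).toLinearMap ∘ₗ (pderiv (Sum.inr (j, 1))).toLinearMap -
    (pderiv (Sum.inl (j, 1))).toLinearMap ∘ₗ (pderiv (Sum.inr (j, 0))).toLinearMap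

/-- The transvectant `(Ψ, Φ)^{ε_1 ⋯ ε_k}`: apply `Ω_1^{ε_1} ⋯ Ω_k^{ε_k}` to `Ψ(x') Φ(x'')` and put
`x' = x'' = x`. -/
def transvectant {k : ℕ} (ε : Fin k → ℕ) (Ψ Φ : FormPoly k) : FormPoly k :=
  rename (Sum.elim id id)
    ((List.ofFn fun j => cayleyOmega j ^ ε j).prod (rename Sum.inl Ψ * rename Sum.inr Φ))

/-- The quadratic covariant `B_d = (f, f)^{(2 - d_1)/2, …, (2 - d_k)/2}` for `d ∈ {0, 2}^k`. -/
def quadCovariant {k : ℕ} (d : Fin k → ℕ) : FormPoly k :=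
  transvectant (fun j => (2 - d j) / 2) (groundForm k) (groundForm k)

/-- The tuples `d ∈ {0, 2}^k` with an even number of entries equal to `0`. -/
def evenTuples (k : ℕ) : Set (Fin k → ℕ) :=
  {d | (∀ j, d j = 0 ∨ d j = 2) ∧ Even (Finset.univ.filter fun j => d j = 0).card}

/-! ### Conjugation and scalar products -/

/-- Complex conjugation of polynomials in the components and their conjugates: coefficients are
conjugated, and `a_I` and `ā_I` are exchanged. -/
def conj {k : ℕ} (P : MixedPoly k) : MixedPoly k :=
  rename Sum.swap (map (starRingEnd ℂ) P)

/-- A holomorphic polynomial as a polynomial in the components and their conjugates. -/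
def ofHol {k : ℕ} (P : HolPoly k) : MixedPoly k := rename Sum.inl P

theorem evalConj_conj {k : ℕ} (a : Idx k → ℂ) (P : MixedPoly k) :
    evalConj a (conj P) = starRingEnd ℂ (evalConj a P) := by
  rw [evalConj, evalConj, conj, eval_rename, eval_map, ← coe_eval₂Hom,
    ← RingHom.comp_apply (starRingEnd ℂ) (eval _)]
  congr 1
  refine MvPolynomial.ringHom_ext (fun c => by simp) fun v => ?_
  cases v <;> simp

/-- The hermitian scalar product `⟨Φ|Ψ⟩` with respect to the auxiliary variables, the components of
the state being regarded as scalars; it is linear in `Φ` and antilinear in `Ψ`. Distinct monomials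
in the auxiliary variables are orthogonal and the squared norm of `∏ x_p ^ m_p` is `∏ m_p!`, which
is the permanent of the matrix of scalar products of its factors. -/
def scalarProduct {k : ℕ} (Φ Ψ : FormPoly k) : MixedPoly k :=
  ∑ m ∈ Φ.support,
    (∏ p, (m p).factorial : ℕ) • (ofHol (coeff m Φ) * conj (ofHol (coeff m Ψ)))

/-- Bidegree weights: `(1, 0)` for `a_I` and `(0, 1)` for `ā_I`. -/
def bidegreeWeight (k : ℕ) : Idx k ⊕ Idx k → ℕ × ℕ :=
  Sum.elim (fun _ => (1, 0)) (fun _ => (0, 1))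

/-- `P` is homogeneous of degree `p` in the `a_I` and of degree `q` in the `ā_I`. -/
def HasBidegree {k : ℕ} (P : MixedPoly k) (p q : ℕ) : Prop :=
  IsWeightedHomogeneous (bidegreeWeight k) P (p, q)

end Qubit

end

noncomputable section

namespace Qubit

open MvPolynomial

/-! Under `SU(2)^k` the conjugate vector `ā`, transported by the symplectic forms of the factors
(`dualVec`), transforms exactly as `a` does (`twistedVal_act`). A polynomial of degree 4 in `a` and
`ā` is therefore a sum of 4-linear forms on `⨂ ℂ²`, one for each type `τ ∈ {0,1}^4` telling which
arguments are `a` and which are the dual of `ā`. Their tensors live in `⨂_j (ℂ²)^{⊗4}` and are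
unique once made equivariant under `S_4`, so invariance of the polynomial is invariance of every
tensor (`exists_of_mem_lsutInvariants`). The `SU(2)`-invariants in `(ℂ²)^{⊗4}` form a plane spanned
by products of two brackets (`eq_sum_pm`); hence the tensors lie in the `k`-th tensor power of that
plane (`exists_wordTensor_eq`). Up to permutation only the number `q` of dual arguments matters, and
type `q` contributes the tensors fixed by `S_{4-q} × S_q` (`sumFormPoly_injective`,
`range_sumFormPoly`).

Dimension: the Klein four-group acts trivially on the plane, on which `S_4` acts through the
irreducible representation of `S_3`. In an eigenbasis of a 3-cycle, with the primitive cube roots of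
unity as eigenvalues, a transposition exchanges the two basis vectors. Fixed tensors correspond to
words in two letters up to exchange of the letters; if `q ≠ 2`, the product of the eigenvalues must
also be 1. This gives `2^{k-1}` for `q = 2` and `(2^{k-1} - (-1)^{k-1})/3` for the other four values
of `q` (`card_words`).

Span: brackets are invariant even under `SL(2, ℂ)`. So `q = 0` gives SLOCC invariants, and `q = 1`,
with the dual argument freed, gives cubic covariants paired with `f`. For `q = 2` take the basis of
the plane that is symmetric, respectively antisymmetric, in the first two vectors: each word becomes
`±⟨B_d|B_d⟩` (`formPoly_pmWord`), and vanishes if the number of antisymmetric letters is odd.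
Complex conjugation reduces `q = 3, 4` to `q = 1, 0`. -/

/-! ### Tensors and homogeneous polynomials -/

section Tensor

variable {n : ℕ} {σ : Type*}

/-- The exponent of the monomial `∏ r, X (I r)`. -/
def expo (I : Fin n → σ) : σ →₀ ℕ := ∑ r, Finsupp.single (I r) 1

theorem prod_X_eq_monomial (I : Fin n → σ) :
    ∏ r, (X (I r) : MvPolynomial σ ℂ) = monomial (expo I) 1 := by
  rw [expo, monomial_sum_one]
  rfl

theorem expo_comp_perm (I : Fin n → σ) (π : Equiv.Perm (Fin n)) : expo (I ∘ π) = expo I :=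
  Equiv.sum_comp π fun r => Finsupp.single (I r) 1

theorem expo_apply [DecidableEq σ] (I : Fin n → σ) (s : σ) :
    expo I s = Fintype.card {r // I r = s} := by
  rw [expo, Finsupp.finsetSum_apply, Fintype.card_subtype, Finset.card_filter]
  exact Finset.sum_congr rfl fun r _ => Finsupp.single_apply

/-- Equal exponents say that the fibres of `I` and `J` over each variable have the same size;
bijections between these fibres glue to a permutation. -/
theorem exists_perm_of_expo_eq {I J : Fin n → σ} (h : expo I = expo J) :
    ∃ π : Equiv.Perm (Fin n), J ∘ π = I := by
  classical
  have e : ∀ s, Nonempty ({r // I r = s} ≃ {r // J r = s}) := fun s =>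
    ⟨Fintype.equivOfCardEq ((expo_apply I s).symm.trans
      ((congrArg (fun f => f s) h).trans (expo_apply J s)))⟩
  refine ⟨((Equiv.sigmaFiberEquiv I).symm.trans
    (Equiv.sigmaCongrRight fun s => (e s).some)).trans (Equiv.sigmaFiberEquiv J), ?_⟩
  funext r
  exact ((e (I r)).some ⟨r, rfl⟩).2

theorem exists_expo_eq {m : σ →₀ ℕ} (h : m.degree = n) : ∃ I : Fin n → σ, expo I = m := by
  classical
  induction n generalizing m with
  | zero => exact ⟨Fin.elim0, by simp [expo, (Finsupp.degree_eq_zero_iff m).1 h]⟩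
  | succ n ih =>
    obtain ⟨s, hs⟩ : ∃ s, m s ≠ 0 := by
      by_contra! h0
      rw [Finsupp.ext (g := 0) h0] at h
      simp at h
    have hm : m - Finsupp.single s 1 + Finsupp.single s 1 = m :=
      tsub_add_cancel_of_le (Finsupp.single_le_iff.2 (Nat.one_le_iff_ne_zero.2 hs))
    obtain ⟨I, hI⟩ := @ih (m - Finsupp.single s 1) (by
      rw [← hm, map_add, Finsupp.degree_single] at h
      omega)
    refine ⟨Fin.cons s I, ?_⟩
    rw [expo, Fin.sum_univ_succ]
    simp only [Fin.cons_zero, Fin.cons_succ]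
    rw [← expo, hI, add_comm, hm]

variable [Fintype σ]

/-- The homogeneous polynomial with tensor of coefficients `t`. -/
def tensorPoly : ((Fin n → σ) → ℂ) →ₗ[ℂ] MvPolynomial σ ℂ where
  toFun t := ∑ I, t I • ∏ r, X (I r)
  map_add' s t := by simp [add_smul, Finset.sum_add_distrib]
  map_smul' c t := by simp [Finset.smul_sum, smul_smul]

theorem tensorPoly_apply (t : (Fin n → σ) → ℂ) :
    tensorPoly t = ∑ I, t I • ∏ r, (X (I r) : MvPolynomial σ ℂ) := rfl

open Classical in
theorem coeff_tensorPoly (t : (Fin n → σ) → ℂ) (m : σ →₀ ℕ) :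
    coeff m (tensorPoly t) = ∑ I with expo I = m, t I := by
  simp only [tensorPoly_apply, prod_X_eq_monomial, coeff_sum, coeff_smul, coeff_monomial]
  simp [Finset.sum_filter]

theorem exists_tensorPoly_eq {P : MvPolynomial σ ℂ} (hP : P.IsHomogeneous n) :
    ∃ t : (Fin n → σ) → ℂ, (∀ (π : Equiv.Perm (Fin n)) I, t (I ∘ π) = t I) ∧
      tensorPoly t = P := by
  classical
  -- The coefficient of a monomial is spread evenly over the multi-indices that produce it.
  refine ⟨fun I => ((Finset.univ.filter fun J : Fin n → σ => expo J = expo I).card : ℂ)⁻¹ *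
    coeff (expo I) P, fun π I => by simp only [expo_comp_perm], ?_⟩
  ext m
  rw [coeff_tensorPoly]
  by_cases hm : ∃ I : Fin n → σ, expo I = m
  · obtain ⟨I, rfl⟩ := hm
    rw [Finset.sum_congr rfl (g := fun _ =>
      ((Finset.univ.filter fun J : Fin n → σ => expo J = expo I).card : ℂ)⁻¹ * coeff (expo I) P)
      fun J hJ => by rw [(Finset.mem_filter.1 hJ).2]]
    rw [Finset.sum_const, nsmul_eq_mul, mul_inv_cancel_left₀]
    exact Nat.cast_ne_zero.2 (Finset.card_ne_zero.2 ⟨I, by simp⟩)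
  · rw [Finset.filter_false_of_mem fun I _ h => hm ⟨I, h⟩, Finset.sum_empty]
    by_contra h
    exact hm (exists_expo_eq (by
      have := hP (Ne.symm h)
      rwa [Finsupp.degree_eq_weight_one]))

/-- The multi-indices producing one monomial form a single `S_n`-orbit. The symmetrized tensor is
constant on it, so the vanishing coefficient is the orbit size times an entry. -/
theorem sum_perm_eq_zero {t : (Fin n → σ) → ℂ} (ht : tensorPoly t = 0) (I : Fin n → σ) :
    ∑ π : Equiv.Perm (Fin n), t (I ∘ π) = 0 := by
  classical
  set t' : (Fin n → σ) → ℂ := fun I => ∑ π : Equiv.Perm (Fin n), t (I ∘ π) with ht'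
  have hsym : ∀ (π : Equiv.Perm (Fin n)) I, t' (I ∘ π) = t' I := fun π I =>
    Equiv.sum_comp (Equiv.mulLeft π) fun ρ : Equiv.Perm (Fin n) => t (I ∘ ρ)
  have h0 : tensorPoly t' = 0 := by
    have : t' = ∑ π : Equiv.Perm (Fin n), fun I => t (I ∘ π) := by
      funext I
      rw [Finset.sum_apply]
    rw [this, map_sum]
    refine Finset.sum_eq_zero fun π _ => ?_
    rw [← ht]
    exact Fintype.sum_equiv (Equiv.arrowCongr π.symm (Equiv.refl σ)) _ _ fun I => by
      simp [Equiv.arrowCongr, Function.comp_def,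
        Equiv.prod_comp π fun r => (X (I r) : MvPolynomial σ ℂ)]
  have h := coeff_tensorPoly t' (expo I)
  rw [h0, coeff_zero, Finset.sum_congr rfl (g := fun _ => t' I), Finset.sum_const,
    nsmul_eq_mul, eq_comm, mul_eq_zero] at h
  · exact h.resolve_left (Nat.cast_ne_zero.2 (Finset.card_ne_zero.2 ⟨I, by simp⟩))
  · intro J hJ
    obtain ⟨π, rfl⟩ := exists_perm_of_expo_eq (Finset.mem_filter.1 hJ).2
    exact hsym π I

end Tensor

/-! ### Invariants of four vectors in `ℂ²` -/

/-- Indices of tensors in the fourth tensor power of `ℂ²`. -/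
abbrev Site : Type := Fin 4 → Fin 2

/-- The bracket of the `r`-th and the `s`-th vector, as a tensor. -/
def bracket (r s : Fin 4) (α : Site) : ℤ := ((α s : ℕ) : ℤ) - ((α r : ℕ) : ℤ)

/-- Two independent invariants of four vectors: `[02][31] - [03][12]` is symmetric and `[01][23]`
is antisymmetric in the first two vectors. -/
def pmInt : Fin 2 → Site → ℤ :=
  ![fun α => bracket 0 2 α * bracket 3 1 α - bracket 0 3 α * bracket 1 2 α,
    fun α => bracket 0 1 α * bracket 2 3 α]

/-- The invariants `pmInt` with complex values. -/
def pm (x : Fin 2) (α : Site) : ℂ := pmInt x α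

/-- The fourth tensor power of a matrix. -/
def siteKernel (h : Matrix (Fin 2) (Fin 2) ℂ) (α β : Site) : ℂ := ∏ r, h (α r) (β r)

theorem sum_site {M : Type*} [AddCommMonoid M] (f : Site → M) :
    ∑ α, f α = ∑ a, ∑ b, ∑ c, ∑ d, f ![a, b, c, d] := by
  let e : Site ≃ Fin 2 × Fin 2 × Fin 2 × Fin 2 :=
    { toFun := fun α => (α 0, α 1, α 2, α 3)
      invFun := fun p => ![p.1, p.2.1, p.2.2.1, p.2.2.2]
      left_inv := fun α => by ext r; fin_cases r <;> rfl
      right_inv := fun p => rfl }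
  rw [← e.symm.sum_comp]
  simp only [Fintype.sum_prod_type]
  rfl

theorem sum_pm_mul_siteKernel {h : Matrix (Fin 2) (Fin 2) ℂ} (hh : h.det = 1) (x : Fin 2)
    (β : Site) : ∑ α, pm x α * siteKernel h α β = pm x β := by
  -- A bracket is a `2 × 2` minor, so each bracket factor of `pm` is multiplied by `det h = 1`.
  have key : ∀ b c : Fin 2, h 0 b * h 1 c - h 1 b * h 0 c = ((c : ℕ) : ℂ) - ((b : ℕ) : ℂ) := by
    rw [Matrix.det_fin_two] at hh
    intro b c
    fin_cases b <;> fin_cases c <;> simp <;>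
      first | ring1 | linear_combination hh | linear_combination -hh
  rw [sum_site]
  fin_cases x <;> simp [Fin.sum_univ_two, pm, pmInt, bracket, siteKernel, Fin.prod_univ_four]
  all_goals
    simp only [← key]
    ring

/-- Two elements of `SU(2)` suffice: a diagonal one kills the components of nonzero weight, and a
rotation leaves only two free parameters among the six components of weight zero. -/
theorem eq_sum_pm {w : Site → ℂ}
    (hw : ∀ h ∈ Matrix.specialUnitaryGroup (Fin 2) ℂ, ∀ β, ∑ α, w α * siteKernel h α β = w β)
    (α : Site) :
    w α = -w ![0, 0, 1, 1] / 2 * pm 0 α + (w ![0, 1, 0, 1] + w ![0, 0, 1, 1] / 2) * pm 1 α := by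
  have h1 : !![(3 + 4 * Complex.I) / 5, 0; 0, (3 - 4 * Complex.I) / 5] ∈
      Matrix.specialUnitaryGroup (Fin 2) ℂ := by
    rw [Matrix.mem_specialUnitaryGroup_iff, Matrix.mem_unitaryGroup_iff]
    constructor
    · ext i j
      fin_cases i <;> fin_cases j <;>
        simp [Matrix.mul_apply, Fin.sum_univ_two, Matrix.star_apply, map_ofNat] <;>
        linear_combination (-16 / 25 : ℂ) * Complex.I_sq
    · simp [Matrix.det_fin_two]
      linear_combination (-16 / 25 : ℂ) * Complex.I_sq
  -- The Pythagorean triple `(3, 4, 5)` keeps this rotation rational.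
  have h2 : !![3 / 5, 4 / 5; -4 / 5, 3 / 5] ∈ Matrix.specialUnitaryGroup (Fin 2) ℂ := by
    rw [Matrix.mem_specialUnitaryGroup_iff, Matrix.mem_unitaryGroup_iff]
    constructor
    · ext i j
      fin_cases i <;> fin_cases j <;>
        simp [Matrix.mul_apply, Fin.sum_univ_two, Matrix.star_apply, map_ofNat] <;> norm_num
    · simp [Matrix.det_fin_two]
      norm_num
  have e1 := hw _ h1
  have e2 := hw _ h2
  have e3 : ∀ a b c d, siteKernel !![(3 + 4 * Complex.I) / 5, 0; 0, (3 - 4 * Complex.I) / 5]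
      ![a, b, c, d] ![a, b, c, d] ≠ 1 → w ![a, b, c, d] = 0 := by
    intro a b c d h
    have := e1 ![a, b, c, d]
    rw [Finset.sum_eq_single ![a, b, c, d]] at this
    · by_contra h0
      exact h (mul_left_cancel₀ h0 (this.trans (mul_one _).symm))
    · intro α _ hα
      obtain ⟨r, hr⟩ := Function.ne_iff.1 hα
      refine mul_eq_zero_of_right _ (Finset.prod_eq_zero (Finset.mem_univ r) ?_)
      generalize α r = x at hr
      generalize ![a, b, c, d] r = y at hr
      fin_cases x <;> fin_cases y <;> simp_all
    · simp
  have z : ∀ a b c d : Fin 2, (a : ℕ) + b + c + d ≠ 2 → w ![a, b, c, d] = 0 := by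
    intro a b c d h
    apply e3
    fin_cases a <;> fin_cases b <;> fin_cases c <;> fin_cases d <;>
      simp [siteKernel, Fin.prod_univ_four] at h ⊢
    all_goals
      intro h
      have h' := congrArg Complex.im h
      norm_num at h'
  have f0 := e2 ![0, 0, 0, 0]
  have f1 := e2 ![0, 0, 0, 1]
  have f2 := e2 ![0, 0, 1, 0]
  have f3 := e2 ![0, 1, 0, 0]
  have f4 := e2 ![1, 0, 0, 0]
  rw [sum_site] at f0 f1 f2 f3 f4
  simp [Fin.sum_univ_two, siteKernel, Fin.prod_univ_four, z] at f0 f1 f2 f3 f4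
  obtain ⟨a, b, c, d, rfl⟩ : ∃ a b c d, α = ![a, b, c, d] :=
    ⟨α 0, α 1, α 2, α 3, by ext r; fin_cases r <;> rfl⟩
  -- For each position, the three weight-zero components with entry 1 there sum to zero: `f0` gives
  -- the vanishing of the sum of all six, and the other equations separate the entries 0 and 1 at
  -- one position.
  have g1 : w ![0, 0, 1, 1] + w ![0, 1, 0, 1] + w ![1, 0, 0, 1] = 0 := by
    linear_combination (25 / 9 : ℂ) * f0 - 25 / 12 * f1
  have g2 : w ![0, 0, 1, 1] + w ![0, 1, 1, 0] + w ![1, 0, 1, 0] = 0 := by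
    linear_combination (25 / 9 : ℂ) * f0 - 25 / 12 * f2
  have g3 : w ![0, 1, 0, 1] + w ![0, 1, 1, 0] + w ![1, 1, 0, 0] = 0 := by
    linear_combination (25 / 9 : ℂ) * f0 - 25 / 12 * f3
  have g4 : w ![1, 0, 0, 1] + w ![1, 0, 1, 0] + w ![1, 1, 0, 0] = 0 := by
    linear_combination (25 / 9 : ℂ) * f0 - 25 / 12 * f4
  have g5 : w ![0, 1, 1, 0] = -w ![0, 0, 1, 1] - w ![0, 1, 0, 1] := by
    linear_combination (g1 + g2 + g3 - g4) / 2
  have g6 : w ![1, 0, 0, 1] = -w ![0, 0, 1, 1] - w ![0, 1, 0, 1] := by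
    linear_combination g1
  have g7 : w ![1, 0, 1, 0] = w ![0, 1, 0, 1] := by
    linear_combination g2 - g5
  have g8 : w ![1, 1, 0, 0] = w ![0, 0, 1, 1] := by
    linear_combination g3 - g5
  fin_cases a <;> fin_cases b <;> fin_cases c <;> fin_cases d <;>
    simp [pm, pmInt, bracket, z, g5, g6, g7, g8] <;> ring

/-! ### Words: tensor products of invariants of four vectors -/

/-- The combination with coefficients `s` of the tensor products `⨂ j, w (σ j)`. -/
def wordTensor {k : ℕ} (w : Fin 2 → Site → ℂ) :
    ((Fin k → Fin 2) → ℂ) →ₗ[ℂ] ((Fin k → Site) → ℂ) where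
  toFun s γ := ∑ σ, s σ * ∏ j, w (σ j) (γ j)
  map_add' s t := by
    funext γ
    simp [add_mul, Finset.sum_add_distrib]
  map_smul' c t := by
    funext γ
    simp [Finset.mul_sum, mul_assoc]

theorem wordTensor_apply {k : ℕ} (w : Fin 2 → Site → ℂ) (s : (Fin k → Fin 2) → ℂ)
    (γ : Fin k → Site) : wordTensor w s γ = ∑ σ, s σ * ∏ j, w (σ j) (γ j) := rfl

/-- `L` is dual to `w`. -/
def IsDual (L w : Fin 2 → Site → ℂ) : Prop :=
  ∀ x y, ∑ α, L x α * w y α = if x = y then 1 else 0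

/-- The sum over `γ` factors over the sites, so products of dual functionals are dual to the words.
-/
theorem sum_prod_mul_wordTensor {k : ℕ} {L w : Fin 2 → Site → ℂ} (h : IsDual L w)
    (s : (Fin k → Fin 2) → ℂ) (σ : Fin k → Fin 2) :
    ∑ γ : Fin k → Site, (∏ j, L (σ j) (γ j)) * wordTensor w s γ = s σ := by
  simp_rw [wordTensor_apply, Finset.mul_sum]
  rw [Finset.sum_comm, Finset.sum_eq_single σ]
  · have : ∀ γ : Fin k → Site, (∏ j, L (σ j) (γ j)) * (s σ * ∏ j, w (σ j) (γ j)) =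
        s σ * ∏ j, (L (σ j) (γ j) * w (σ j) (γ j)) := fun γ => by
      rw [Finset.prod_mul_distrib]
      ring
    simp_rw [this, ← Finset.mul_sum]
    rw [← Fintype.piFinset_univ,
      ← Finset.prod_univ_sum (fun _ => Finset.univ) (fun j α => L (σ j) α * w (σ j) α)]
    simp [h _ _]
  · intro τ _ hτ
    have : ∀ γ : Fin k → Site, (∏ j, L (σ j) (γ j)) * (s τ * ∏ j, w (τ j) (γ j)) =
        s τ * ∏ j, (L (σ j) (γ j) * w (τ j) (γ j)) := fun γ => by
      rw [Finset.prod_mul_distrib]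
      ring
    simp_rw [this, ← Finset.mul_sum]
    rw [← Fintype.piFinset_univ,
      ← Finset.prod_univ_sum (fun _ => Finset.univ) (fun j α => L (σ j) α * w (τ j) α)]
    obtain ⟨j, hj⟩ := Function.ne_iff.1 hτ
    rw [Finset.prod_eq_zero (Finset.mem_univ j), mul_zero]
    rw [h, if_neg hj.symm]
  · simp

theorem wordTensor_injective {k : ℕ} {L w : Fin 2 → Site → ℂ} (h : IsDual L w) :
    Function.Injective (wordTensor (k := k) w) := fun s t hst => by
  funext σ
  rw [← sum_prod_mul_wordTensor h s, ← sum_prod_mul_wordTensor h t, hst]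

/-- In each argument, `t` is a combination of the tensors `w 0` and `w 1`. -/
def IsSlicewise {k : ℕ} (w : Fin 2 → Site → ℂ) (t : (Fin k → Site) → ℂ) : Prop :=
  ∀ γ j, ∃ c : Fin 2 → ℂ, ∀ α, t (Function.update γ j α) = ∑ x, c x * w x α

theorem isSlicewise_wordTensor {k : ℕ} (w : Fin 2 → Site → ℂ) (s : (Fin k → Fin 2) → ℂ) :
    IsSlicewise w (wordTensor w s) := by
  intro γ j
  refine ⟨fun x => ∑ σ with σ j = x, s σ * ∏ i ∈ Finset.univ.erase j, w (σ i) (γ i),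
    fun α => ?_⟩
  simp_rw [Finset.sum_mul]
  rw [wordTensor_apply, ← Finset.sum_fiberwise (s := Finset.univ) (fun σ : Fin k → Fin 2 => σ j)]
  refine Finset.sum_congr rfl fun x _ => Finset.sum_congr rfl fun σ hσ => ?_
  rw [← (Finset.mem_filter.1 hσ).2, ← Finset.mul_prod_erase Finset.univ _ (Finset.mem_univ j),
    Function.update_self, Finset.prod_congr rfl (fun i hi => by
      rw [Function.update_of_ne (Finset.ne_of_mem_erase hi)])]
  ring

/-- A tensor lying in the span of `w` in each slot separately lies in the tensor power of this span.
By induction on `k`: contracting the first slot with `L 0` and `L 1` leaves tensors of the same kind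
with one slot fewer, and these contractions are the coefficients of the first slot. -/
theorem exists_wordTensor_eq {k : ℕ} {L w : Fin 2 → Site → ℂ} (h : IsDual L w)
    {t : (Fin k → Site) → ℂ} (ht : IsSlicewise w t) : ∃ s, wordTensor w s = t := by
  have dual : ∀ {c : Fin 2 → ℂ} {f : Site → ℂ}, (∀ α, f α = ∑ x, c x * w x α) →
      ∀ x, c x = ∑ α, L x α * f α := by
    intro c f hf x
    simp_rw [hf, Finset.mul_sum]
    rw [Finset.sum_comm]
    have : ∀ y, ∑ α, L x α * (c y * w y α) = c y * if x = y then 1 else 0 := fun y => by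
      rw [← h, Finset.mul_sum]
      exact Finset.sum_congr rfl fun α _ => by ring
    simp [this]
  induction k with
  | zero =>
    refine ⟨fun _ => t Fin.elim0, ?_⟩
    funext γ
    rw [wordTensor_apply]
    simp [Subsingleton.elim γ Fin.elim0]
  | succ k ih =>
    have key : ∀ x, IsSlicewise w fun γ : Fin k → Site => ∑ α, L x α * t (Fin.cons α γ) := by
      intro x γ j
      choose c hc using fun α => ht (Fin.cons α γ) j.succ
      refine ⟨fun y => ∑ α, L x α * c α y, fun β => ?_⟩
      simp_rw [Finset.sum_mul]
      rw [Finset.sum_comm]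
      refine Finset.sum_congr rfl fun α _ => ?_
      rw [Fin.cons_update, hc, Finset.mul_sum]
      exact Finset.sum_congr rfl fun α _ => by ring
    choose s hs using fun x => ih (key x)
    refine ⟨fun σ => s (σ 0) (Fin.tail σ), ?_⟩
    funext γ
    obtain ⟨c, hc⟩ := ht γ 0
    have h1 := hc (γ 0)
    rw [Function.update_eq_self] at h1
    rw [h1, wordTensor_apply, ← (Fin.consEquiv fun _ => Fin 2).sum_comp, Fintype.sum_prod_type]
    refine Finset.sum_congr rfl fun x _ => ?_
    rw [dual hc x]
    have h2 : ∀ α, t (Function.update γ 0 α) = t (Fin.cons α (Fin.tail γ)) := fun α => by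
      rw [← Fin.cons_self_tail (Function.update γ 0 α)]
      simp
    simp_rw [h2]
    rw [← congrFun (hs x) (Fin.tail γ), wordTensor_apply, Finset.sum_mul]
    refine Finset.sum_congr rfl fun σ _ => ?_
    simp [Fin.consEquiv, Fin.prod_univ_succ, Fin.tail]
    ring

theorem IsSlicewise.of_forall {k : ℕ} {w w' : Fin 2 → Site → ℂ} {t : (Fin k → Site) → ℂ}
    (ht : IsSlicewise w t) (M : Matrix (Fin 2) (Fin 2) ℂ) (h : ∀ x α, w x α = ∑ y, M x y * w' y α) :
    IsSlicewise w' t := by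
  intro γ j
  obtain ⟨c, hc⟩ := ht γ j
  refine ⟨fun y => ∑ x, c x * M x y, fun α => ?_⟩
  rw [hc]
  simp_rw [h, Finset.mul_sum, Finset.sum_mul]
  rw [Finset.sum_comm]
  simp [mul_assoc]

/-! ### Permutations of the four vectors -/

/-- The action of permutations of the four vectors on tensors. -/
def permTensor {k : ℕ} (π : Equiv.Perm (Fin 4)) (t : (Fin k → Site) → ℂ) : (Fin k → Site) → ℂ :=
  fun γ => t fun j => γ j ∘ π

theorem permTensor_mul {k : ℕ} (π ρ : Equiv.Perm (Fin 4)) (t : (Fin k → Site) → ℂ) :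
    permTensor (π * ρ) t = permTensor π (permTensor ρ t) := rfl

theorem permTensor_wordTensor {k : ℕ} {w : Fin 2 → Site → ℂ} {π : Equiv.Perm (Fin 4)}
    {c : Fin 2 → ℂ} (h : ∀ x α, w x (α ∘ π) = c x * w x α) (s : (Fin k → Fin 2) → ℂ) :
    permTensor π (wordTensor w s) = wordTensor w fun σ => (∏ j, c (σ j)) * s σ := by
  funext γ
  simp only [permTensor, wordTensor_apply, h, Finset.prod_mul_distrib]
  exact Finset.sum_congr rfl fun σ _ => by ring

theorem permTensor_wordTensor_rev {k : ℕ} {w : Fin 2 → Site → ℂ} {π : Equiv.Perm (Fin 4)}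
    (h : ∀ x α, w x (α ∘ π) = w x.rev α) (s : (Fin k → Fin 2) → ℂ) :
    permTensor π (wordTensor w s) = wordTensor w fun σ => s fun j => (σ j).rev := by
  funext γ
  simp only [permTensor, wordTensor_apply, h]
  exact Fintype.sum_equiv (Equiv.arrowCongr (Equiv.refl _) Fin.revPerm) _ _ fun σ => by
    simp [Equiv.arrowCongr]

/-! ### Two bases of the invariants of four vectors -/

/-- A basis dual to `pm`. -/
def pmDual : Fin 2 → Site → ℂ :=
  ![fun α => if α = ![0, 0, 1, 1] then -1 / 2 else 0,
    fun α => if α = ![0, 1, 0, 1] then 1 else if α = ![0, 0, 1, 1] then 1 / 2 else 0]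

theorem isDual_pm : IsDual pmDual pm := by
  intro x y
  rw [sum_site]
  fin_cases x <;> fin_cases y <;> simp [Fin.sum_univ_two, pmDual, pm, pmInt, bracket] <;> norm_num

/-- A square root of `-3/4`. -/
def halfSqrt : ℂ := Complex.I * (√3 : ℝ) / 2

theorem halfSqrt_sq : halfSqrt ^ 2 = -3 / 4 := by
  have : ((√3 : ℝ) : ℂ) ^ 2 = 3 := by
    rw [← Complex.ofReal_pow, Real.sq_sqrt (by norm_num)]
    norm_num
  rw [halfSqrt, div_pow, mul_pow, this, Complex.I_sq]
  norm_num

theorem halfSqrt_ne_zero : halfSqrt ≠ 0 := fun h => by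
  have := halfSqrt_sq
  rw [h] at this
  norm_num at this

/-- A basis of the invariants of four vectors in which all permutations act by monomial
matrices. -/
def uv (x : Fin 2) (α : Site) : ℂ := halfSqrt * pm 0 α + ![3 / 2, -3 / 2] x * pm 1 α

/-- A basis dual to `uv`. -/
def uvDual (x : Fin 2) (α : Site) : ℂ :=
  1 / (2 * halfSqrt) * pmDual 0 α + ![1 / 3, -1 / 3] x * pmDual 1 α

theorem isDual_uv : IsDual uvDual uv := by
  intro x y
  have h := isDual_pm
  have e : ∀ α, uvDual x α * uv y α =
      1 / 2 * (pmDual 0 α * pm 0 α) +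
      1 / (2 * halfSqrt) * ![3 / 2, -3 / 2] y * (pmDual 0 α * pm 1 α) +
      ![1 / 3, -1 / 3] x * halfSqrt * (pmDual 1 α * pm 0 α) +
      ![1 / 3, -1 / 3] x * ![3 / 2, -3 / 2] y * (pmDual 1 α * pm 1 α) := by
    intro α
    have := halfSqrt_ne_zero
    rw [uvDual, uv]
    field_simp
    ring
  simp_rw [e, Finset.sum_add_distrib, ← Finset.mul_sum, h _ _]
  fin_cases x <;> fin_cases y <;> norm_num

theorem isSlicewise_uv_iff {k : ℕ} {t : (Fin k → Site) → ℂ} :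
    IsSlicewise uv t ↔ IsSlicewise pm t := by
  have := halfSqrt_ne_zero
  constructor
  · refine fun h => h.of_forall !![halfSqrt, 3 / 2; halfSqrt, -3 / 2] fun x α => ?_
    fin_cases x <;> simp [uv, Fin.sum_univ_two]
  · refine fun h => h.of_forall
      !![1 / (2 * halfSqrt), 1 / (2 * halfSqrt); 1 / 3, -1 / 3] fun x α => ?_
    fin_cases x <;> simp [uv, Fin.sum_univ_two] <;> field_simp <;> ring

/-- The eigenvalues of the cyclic permutation of the last three vectors. -/
def cycVal (x : Fin 2) : ℂ := ![-halfSqrt - 1 / 2, halfSqrt - 1 / 2] x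

/-- The cyclic permutation of the last three vectors. -/
def cyc : Equiv.Perm (Fin 4) := Equiv.swap 1 2 * Equiv.swap 2 3

/-- The 3-cycle permutes the three pairings of the four vectors, whose bracket products satisfy the
Plücker relation. The identities are doubled below to be decidable over `ℤ`. -/
theorem pm_comp_cyc (α : Site) : pm 0 (α ∘ cyc) = -3 / 2 * pm 1 α - 1 / 2 * pm 0 α ∧
    pm 1 (α ∘ cyc) = -1 / 2 * pm 1 α + 1 / 2 * pm 0 α := by
  have h : ∀ α : Site, 2 * pmInt 0 (α ∘ cyc) = -3 * pmInt 1 α - pmInt 0 α ∧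
      2 * pmInt 1 (α ∘ cyc) = -pmInt 1 α + pmInt 0 α := by decide
  obtain ⟨h0, h1⟩ := h α
  have h0' := congrArg (Int.cast : ℤ → ℂ) h0
  have h1' := congrArg (Int.cast : ℤ → ℂ) h1
  push_cast at h0' h1'
  simp only [pm]
  constructor
  · linear_combination h0' / 2
  · linear_combination h1' / 2

theorem pm_comp_swap (x : Fin 2) (α : Site) :
    pm x (α ∘ Equiv.swap 0 1) = ![1, -1] x * pm x α := by
  have h : ∀ (x : Fin 2) (α : Site), pmInt x (α ∘ Equiv.swap 0 1) = ![1, -1] x * pmInt x α := by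
    decide
  rw [pm, h]
  fin_cases x <;> simp [pm]

/-- The two eigenvalues are the primitive cube roots of unity, because `halfSqrt` is `i√3/2`. -/
theorem uv_comp_cyc (x : Fin 2) (α : Site) : uv x (α ∘ cyc) = cycVal x * uv x α := by
  obtain ⟨h0, h1⟩ := pm_comp_cyc α
  have hs := halfSqrt_sq
  rw [uv, uv, h0, h1]
  fin_cases x
  · simp [cycVal]
    linear_combination pm 0 α * hs
  · simp [cycVal]
    linear_combination -pm 0 α * hs

theorem uv_comp_swap (x : Fin 2) (α : Site) : uv x (α ∘ Equiv.swap 0 1) = uv x.rev α := by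
  rw [uv, uv, pm_comp_swap, pm_comp_swap]
  fin_cases x <;> simp <;> ring

/-- The nontrivial double transpositions and the identity. -/
def kleinFour : List (Equiv.Perm (Fin 4)) :=
  [1, Equiv.swap 0 1 * Equiv.swap 2 3, Equiv.swap 0 2 * Equiv.swap 1 3,
    Equiv.swap 0 3 * Equiv.swap 1 2]

/-- In a product of two complementary brackets, a double transposition exchanges the brackets,
reverses both, or does both; the signs cancel. -/
theorem pm_comp_kleinFour {π : Equiv.Perm (Fin 4)} (hπ : π ∈ kleinFour) (x : Fin 2) (α : Site) :
    pm x (α ∘ π) = pm x α := by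
  have h : ∀ π ∈ kleinFour, ∀ (x : Fin 2) (α : Site), pmInt x (α ∘ π) = pmInt x α := by
    decide
  rw [pm, h π hπ, pm]

/-! ### Tensors invariant under a group of permutations of the four vectors -/

/-- The sorted type `0 ⋯ 0 1 ⋯ 1` with `q` entries `1`. -/
def sortedType (q : Fin 5) : Site := fun r => if (r : ℕ) + q < 4 then 0 else 1

/-- The tensors of invariants of `SL(2, ℂ)^k`. -/
def sliceSpace (k : ℕ) : Submodule ℂ ((Fin k → Site) → ℂ) := LinearMap.range (wordTensor pm)

theorem mem_sliceSpace {k : ℕ} {t : (Fin k → Site) → ℂ} : t ∈ sliceSpace k ↔ IsSlicewise pm t :=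
  ⟨by rintro ⟨s, rfl⟩; exact isSlicewise_wordTensor pm s, exists_wordTensor_eq isDual_pm⟩

theorem sliceSpace_eq_uv (k : ℕ) : sliceSpace k = LinearMap.range (wordTensor uv) := by
  ext t
  rw [mem_sliceSpace, ← isSlicewise_uv_iff]
  exact ⟨exists_wordTensor_eq isDual_uv, by rintro ⟨s, rfl⟩; exact isSlicewise_wordTensor uv s⟩

theorem permTensor_kleinFour {k : ℕ} {t : (Fin k → Site) → ℂ} (ht : t ∈ sliceSpace k)
    {π : Equiv.Perm (Fin 4)} (hπ : π ∈ kleinFour) : permTensor π t = t := by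
  obtain ⟨s, rfl⟩ := ht
  rw [permTensor_wordTensor (c := fun _ => 1) fun x α => by rw [pm_comp_kleinFour hπ, one_mul]]
  simp

/-- The tensors in `sliceSpace k` invariant under the stabilizer of the type `sortedType q`. -/
def stabSpace (k : ℕ) (q : Fin 5) : Submodule ℂ ((Fin k → Site) → ℂ) where
  carrier := {t | t ∈ sliceSpace k ∧
    ∀ π : Equiv.Perm (Fin 4), sortedType q ∘ π = sortedType q → permTensor π t = t}
  zero_mem' := ⟨zero_mem _, fun π _ => rfl⟩
  add_mem' := fun {s t} hs ht => ⟨add_mem hs.1 ht.1, fun π hπ => by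
    nth_rewrite 2 [← hs.2 π hπ, ← ht.2 π hπ]
    rfl⟩
  smul_mem' := fun c t ht => ⟨Submodule.smul_mem _ c ht.1, fun π hπ => by
    nth_rewrite 2 [← ht.2 π hπ]
    rfl⟩

/-- Modulo the Klein four-group `V`, the stabilizer of a type maps onto `S_4/V ≅ S_3` if `q ≠ 2`,
and onto the group of order 2 generated by a transposition if `q = 2`. As `V` acts trivially,
generators of the image suffice. -/
theorem mem_stabSpace_iff {k : ℕ} {q : Fin 5} {t : (Fin k → Site) → ℂ} (ht : t ∈ sliceSpace k) :
    t ∈ stabSpace k q ↔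
      permTensor (Equiv.swap 0 1) t = t ∧ (q ≠ 2 → permTensor cyc t = t) := by
  constructor
  · intro h
    have h1 : ∀ π : Equiv.Perm (Fin 4),
        (∃ v ∈ kleinFour, sortedType q ∘ (π * v : Equiv.Perm (Fin 4)) = sortedType q) →
          permTensor π t = t := by
      rintro π ⟨v, hv, hπ⟩
      have := h.2 _ hπ
      rwa [permTensor_mul, permTensor_kleinFour ht hv] at this
    have d1 : ∀ q, ∃ v ∈ kleinFour,
        sortedType q ∘ (Equiv.swap 0 1 * v : Equiv.Perm (Fin 4)) = sortedType q := by decide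
    have d2 : ∀ q, q ≠ 2 → ∃ v ∈ kleinFour,
        sortedType q ∘ (cyc * v : Equiv.Perm (Fin 4)) = sortedType q := by decide
    exact ⟨h1 _ (d1 q), fun hq => h1 _ (d2 q hq)⟩
  · rintro ⟨h1, h2⟩
    refine ⟨ht, fun π hπ => ?_⟩
    have e : ∀ v ∈ kleinFour, permTensor v t = t := fun v hv => permTensor_kleinFour ht hv
    by_cases hq : q = 2
    · subst hq
      obtain ⟨v, hv, h | h⟩ : ∃ v ∈ kleinFour, π = v ∨ π = Equiv.swap 0 1 * v := by
        revert π; decide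
      · rw [h, e v hv]
      · rw [h, permTensor_mul, e v hv, h1]
    · specialize h2 hq
      obtain ⟨v, hv, h⟩ : ∃ v ∈ kleinFour, ∃ i : Fin 3, π = cyc ^ (i : ℕ) * v ∨
          π = Equiv.swap 0 1 * cyc ^ (i : ℕ) * v := by
        clear hπ
        revert π; decide
      have e3 : ∀ n : ℕ, permTensor (cyc ^ n) t = t := fun n => by
        induction n with
        | zero => rfl
        | succ n ih => rw [pow_succ, permTensor_mul, h2, ih]
      obtain ⟨i, h | h⟩ := h
      · rw [h, permTensor_mul, e v hv, e3]
      · rw [h, permTensor_mul, e v hv, permTensor_mul, e3, h1]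

/-- The coefficients of the tensors in `stabSpace k q` with respect to `uv`. -/
def wordSpace (k : ℕ) (q : Fin 5) : Submodule ℂ ((Fin k → Fin 2) → ℂ) where
  carrier := {s | (∀ σ, s (fun j => (σ j).rev) = s σ) ∧
    (q ≠ 2 → ∀ σ, ∏ j, cycVal (σ j) ≠ 1 → s σ = 0)}
  zero_mem' := ⟨fun _ => rfl, fun _ _ _ => rfl⟩
  add_mem' := fun hs ht => ⟨fun σ => congrArg₂ (· + ·) (hs.1 σ) (ht.1 σ), fun hq σ hσ => by
    rw [Pi.add_apply, hs.2 hq σ hσ, ht.2 hq σ hσ, add_zero]⟩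
  smul_mem' := fun c s hs => ⟨fun σ => congrArg (c * ·) (hs.1 σ), fun hq σ hσ => by
    rw [Pi.smul_apply, hs.2 hq σ hσ, smul_zero]⟩

theorem stabSpace_eq_map (k : ℕ) (q : Fin 5) :
    stabSpace k q = (wordSpace k q).map (wordTensor uv) := by
  have inj := wordTensor_injective (k := k) isDual_uv
  have key : ∀ s, wordTensor uv s ∈ stabSpace k q ↔ s ∈ wordSpace k q := by
    intro s
    rw [mem_stabSpace_iff (by rw [sliceSpace_eq_uv]; exact ⟨s, rfl⟩),
      permTensor_wordTensor_rev uv_comp_swap, permTensor_wordTensor uv_comp_cyc, inj.eq_iff,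
      inj.eq_iff]
    refine and_congr funext_iff (imp_congr_right fun _ => funext_iff.trans
      (forall_congr' fun σ => ?_))
    rw [mul_left_eq_self₀, or_iff_not_imp_left]
  ext t
  rw [Submodule.mem_map]
  constructor
  · intro ht
    have h := ht.1
    rw [sliceSpace_eq_uv] at h
    obtain ⟨s, rfl⟩ := h
    exact ⟨s, (key s).1 ht, rfl⟩
  · rintro ⟨s, hs, rfl⟩
    exact (key s).2 hs

/-! ### Dimensions -/

-- A function invariant under exchange of the letters is determined by its values on words starting
-- with 0. The exchange inverts the product of eigenvalues, so the support condition is compatible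
-- with it.
open Classical in
theorem finrank_wordSpace (n : ℕ) (q : Fin 5) :
    Module.finrank ℂ (wordSpace (n + 1) q) =
      Fintype.card {τ : Fin n → Fin 2 // q = 2 ∨ cycVal 0 * ∏ j, cycVal (τ j) = 1} := by
  have rev_prod : ∀ σ : Fin (n + 1) → Fin 2, ∏ j, cycVal (σ j).rev = (∏ j, cycVal (σ j))⁻¹ := by
    intro σ
    rw [← Finset.prod_inv_distrib]
    refine Finset.prod_congr rfl fun j _ => eq_inv_of_mul_eq_one_left ?_
    have hs := halfSqrt_sq
    generalize σ j = x
    fin_cases x <;> simp [cycVal] <;> linear_combination -hs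
  rw [← Module.finrank_fintype_fun_eq_card ℂ]
  let e : wordSpace (n + 1) q →ₗ[ℂ]
      ({τ : Fin n → Fin 2 // q = 2 ∨ cycVal 0 * ∏ j, cycVal (τ j) = 1} → ℂ) :=
    { toFun := fun s τ => s.1 (Fin.cons 0 τ.1)
      map_add' := fun _ _ => rfl
      map_smul' := fun _ _ => rfl }
  have fin2 : ∀ x : Fin 2, x ≠ 0 → x.rev = 0 := by decide
  have cons_eq : ∀ σ : Fin (n + 1) → Fin 2, σ 0 = 0 → Fin.cons 0 (Fin.tail σ) = σ := fun σ h => by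
    rw [← h]
    exact Fin.cons_self_tail σ
  refine (LinearEquiv.ofBijective e ⟨?_, ?_⟩).finrank_eq
  · rw [injective_iff_map_eq_zero]
    intro s hs
    have h0 : ∀ σ : Fin (n + 1) → Fin 2, σ 0 = 0 → s.1 σ = 0 := by
      intro σ hσ
      by_cases h : q = 2 ∨ cycVal 0 * ∏ j, cycVal (Fin.tail σ j) = 1
      · have := congrFun hs ⟨Fin.tail σ, h⟩
        rw [← cons_eq σ hσ]
        exact this
      · push Not at h
        refine s.2.2 h.1 σ ?_
        rw [Fin.prod_univ_succ, hσ]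
        exact h.2
    ext σ
    by_cases hσ : σ 0 = 0
    · exact h0 σ hσ
    · rw [← s.2.1 σ]
      exact h0 _ (fin2 _ hσ)
  · intro f
    let F : (Fin n → Fin 2) → ℂ := fun τ =>
      if h : q = 2 ∨ cycVal 0 * ∏ j, cycVal (τ j) = 1 then f ⟨τ, h⟩ else 0
    let s : (Fin (n + 1) → Fin 2) → ℂ := fun σ =>
      if σ 0 = 0 then F (Fin.tail σ) else F (Fin.tail fun j => (σ j).rev)
    have hF : ∀ σ : Fin (n + 1) → Fin 2, σ 0 = 0 → q ≠ 2 → ∏ j, cycVal (σ j) ≠ 1 →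
        F (Fin.tail σ) = 0 := by
      intro σ h0 hq h
      refine dif_neg ?_
      rintro (h' | h')
      · exact hq h'
      · rw [Fin.prod_univ_succ, h0] at h
        exact h h'
    refine ⟨⟨s, fun σ => ?_, fun hq σ hσ => ?_⟩, ?_⟩
    · by_cases h : σ 0 = 0
      · simp [s, h]
      · simp only [s, h, fin2 _ h, if_true, if_false]
    · by_cases h : σ 0 = 0
      · simp only [s, h, if_true]
        exact hF σ h hq hσ
      · simp only [s, h, if_false]
        refine hF (fun j => (σ j).rev) (fin2 _ h) hq ?_
        rw [rev_prod]
        exact fun h' => hσ (inv_eq_one.1 h')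
    · funext τ
      have : s (Fin.cons 0 τ.1) = f τ := by
        simp only [s, Fin.cons_zero, if_true, Fin.tail_cons]
        exact dif_pos τ.2
      exact this

theorem cycVal_mul : cycVal 0 * cycVal 0 = cycVal 1 ∧ cycVal 0 * cycVal 1 = 1 ∧
    cycVal 1 * cycVal 0 = 1 ∧ cycVal 1 * cycVal 1 = cycVal 0 := by
  have hs := halfSqrt_sq
  simp [cycVal]
  refine ⟨?_, ?_, ?_, ?_⟩
  · linear_combination hs
  · linear_combination -hs
  · linear_combination -hs
  · linear_combination hs

theorem cycVal_ne_one : cycVal 0 ≠ 1 ∧ cycVal 1 ≠ 1 := by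
  have hs := halfSqrt_sq
  constructor <;> intro h <;> simp [cycVal] at h
  · rw [show halfSqrt = -3 / 2 by linear_combination -h] at hs
    norm_num at hs
  · rw [show halfSqrt = 3 / 2 by linear_combination h] at hs
    norm_num at hs

-- This is the Fourier count on the cube roots of unity: the trivial character contributes `2^n`,
-- and each of the other two contributes `(-1)^n` times `x` or its inverse. The starting value `x`
-- makes the induction, by removal of the first letter, close up.
open Classical in
theorem card_words (n : ℕ) {x : ℂ} (hx : x = 1 ∨ x = cycVal 0 ∨ x = cycVal 1) :
    3 * (Fintype.card {τ : Fin n → Fin 2 // x * ∏ j, cycVal (τ j) = 1} : ℚ) =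
      2 ^ n + (-1) ^ n * if x = 1 then 2 else -1 := by
  rw [Fintype.card_subtype, Finset.card_filter, Nat.cast_sum]
  induction n generalizing x with
  | zero =>
    by_cases h : x = 1 <;> (simp [h]; try norm_num)
  | succ n ih =>
    obtain ⟨m1, m2, m3, m4⟩ := cycVal_mul
    obtain ⟨n1, n2⟩ := cycVal_ne_one
    have e : ∀ y : Fin 2, x * cycVal y = 1 ∨ x * cycVal y = cycVal 0 ∨ x * cycVal y = cycVal 1 := by
      intro y
      obtain rfl | rfl | rfl := hx <;> fin_cases y <;> simp [m1, m2, m3, m4]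
    rw [← (Fin.consEquiv fun _ => Fin 2).sum_comp, Fintype.sum_prod_type, Fin.sum_univ_two]
    simp only [Fin.consEquiv, Equiv.coe_fn_mk, Fin.prod_univ_succ, Fin.cons_zero, Fin.cons_succ,
      ← mul_assoc]
    rw [mul_add, ih (e 0), ih (e 1)]
    obtain rfl | rfl | rfl := hx <;> simp [m1, m2, m3, m4, n1, n2] <;> ring

theorem finrank_stabSpace_two (n : ℕ) : Module.finrank ℂ (stabSpace (n + 1) 2) = 2 ^ n := by
  classical
  rw [stabSpace_eq_map, LinearEquiv.finrank_eq (Submodule.equivMapOfInjective _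
    (wordTensor_injective isDual_uv) _).symm, finrank_wordSpace]
  simp

theorem finrank_stabSpace (n : ℕ) {q : Fin 5} (hq : q ≠ 2) :
    3 * (Module.finrank ℂ (stabSpace (n + 1) q) : ℚ) = 2 ^ n - (-1) ^ n := by
  classical
  rw [stabSpace_eq_map, LinearEquiv.finrank_eq (Submodule.equivMapOfInjective _
    (wordTensor_injective isDual_uv) _).symm, finrank_wordSpace]
  have := card_words n (x := cycVal 0) (by simp)
  simp only [hq, false_or]
  rw [this, if_neg cycVal_ne_one.1]
  ring

/-! ### Polynomials in the components and their conjugates -/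

theorem eq_of_evalConj_eq {k : ℕ} {P Q : MixedPoly k} (h : ∀ a, evalConj a P = evalConj a Q) :
    P = Q := by
  let φ : Idx k ⊕ Idx k → MvPolynomial (Idx k ⊕ Idx k) ℂ :=
    Sum.elim (fun I => X (Sum.inl I) + C Complex.I * X (Sum.inr I))
      (fun I => X (Sum.inl I) - C Complex.I * X (Sum.inr I))
  have hφ : ∀ (x : Idx k ⊕ Idx k → ℂ) (R : MixedPoly k),
      eval x (aeval φ R) = eval (fun v => eval x (φ v)) R := by
    intro x R
    induction R using MvPolynomial.induction_on with
    | C c => simp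
    | add p q hp hq => simp only [map_add, hp, hq]
    | mul_X p v hp => simp only [map_mul, hp, aeval_X, eval_X]
  -- With `a = x + iy` the hypothesis says that two polynomials agree at all real `x, y`; hence they
  -- are equal. The substitution `φ` is undone below by solving for `x` and `y`.
  have key : aeval φ P = aeval φ Q := by
    refine funext_set (fun _ => Set.range ((↑) : ℝ → ℂ))
      (fun _ => Set.infinite_range_of_injective Complex.ofReal_injective) fun x hx => ?_
    rw [hφ, hφ]
    have hx' : ∀ v, ∃ y : ℝ, (y : ℂ) = x v := fun v => hx v (Set.mem_univ v)
    choose y hy using hx'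
    have e : (fun v => eval x (φ v)) =
        Sum.elim (fun I => x (Sum.inl I) + Complex.I * x (Sum.inr I))
          fun I => starRingEnd ℂ (x (Sum.inl I) + Complex.I * x (Sum.inr I)) := by
      funext v
      rcases v with I | I
      · simp [φ]
      · simp [φ, ← hy]
        ring
    rw [e]
    exact h _
  refine MvPolynomial.funext fun z => ?_
  have h2 := congrArg (eval (Sum.elim (fun I => (z (Sum.inl I) + z (Sum.inr I)) / 2)
    fun I => (z (Sum.inl I) - z (Sum.inr I)) / (2 * Complex.I))) key
  rw [hφ, hφ] at h2
  have e : (fun v => eval (Sum.elim (fun I => (z (Sum.inl I) + z (Sum.inr I)) / 2)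
      fun I => (z (Sum.inl I) - z (Sum.inr I)) / (2 * Complex.I)) (φ v)) = z := by
    have := Complex.I_ne_zero
    funext v
    rcases v with I | I <;> simp [φ] <;> field_simp <;> ring
  rwa [e] at h2

/-- The product of the signs `1` of `0` and `-1` of `1`. -/
def sgnIdx {k : ℕ} (I : Idx k) : ℂ := ∏ j, ![1, -1] (I j)

theorem sgnIdx_mul_self {k : ℕ} (I : Idx k) : sgnIdx I * sgnIdx I = 1 := by
  rw [sgnIdx, ← Finset.prod_mul_distrib]
  refine Finset.prod_eq_one fun j _ => ?_
  generalize I j = x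
  fin_cases x <;> simp

/-- The exchange of `0` and `1` in a multi-index. -/
def flipIdx {k : ℕ} (I : Idx k) : Idx k := fun j => (I j).rev

@[simp]
theorem flipIdx_flipIdx {k : ℕ} (I : Idx k) : flipIdx (flipIdx I) = I := by
  funext j
  simp [flipIdx]

/-! ### Forms in four vectors of `⨂ ℂ²` and the group action on them -/

section Algebra

variable {R S : Type*} [CommRing R] [Algebra ℂ R] [CommRing S] [Algebra ℂ S] {k : ℕ}

/-- The identification of `⨂ ℂ²` with its dual given by the symplectic forms on the factors. -/
def dualVec (z : Idx k → R) : Idx k → R := fun I => sgnIdx I • z (flipIdx I)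

/-- The multilinear form with tensor of coefficients `t`. -/
def tensorForm (t : (Fin k → Site) → ℂ) (y : Fin 4 → Idx k → R) : R :=
  ∑ γ, t γ • ∏ r, y r fun j => γ j r

theorem map_tensorForm (φ : R →ₐ[ℂ] S) (t : (Fin k → Site) → ℂ) (y : Fin 4 → Idx k → R) :
    φ (tensorForm t y) = tensorForm t fun r I => φ (y r I) := by
  simp [tensorForm]

theorem tensorForm_permTensor (π : Equiv.Perm (Fin 4)) (t : (Fin k → Site) → ℂ)
    (y : Fin 4 → Idx k → R) :
    tensorForm (permTensor π t) y = tensorForm t fun r => y (π r) := by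
  refine Fintype.sum_equiv
    (Equiv.arrowCongr (Equiv.refl _) (Equiv.arrowCongr π.symm (Equiv.refl _))) _ _ fun γ => ?_
  rw [← Equiv.prod_comp π]
  simp [Equiv.arrowCongr, permTensor, Function.comp_def]

end Algebra

theorem tensorForm_add {R : Type*} [CommRing R] [Algebra ℂ R] {k : ℕ}
    (s t : (Fin k → Site) → ℂ) (y : Fin 4 → Idx k → R) :
    tensorForm (s + t) y = tensorForm s y + tensorForm t y := by
  simp [tensorForm, add_smul, Finset.sum_add_distrib]

theorem tensorForm_smul {R : Type*} [CommRing R] [Algebra ℂ R] {k : ℕ} (c : ℂ)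
    (t : (Fin k → Site) → ℂ) (y : Fin 4 → Idx k → R) :
    tensorForm (c • t) y = c • tensorForm t y := by
  simp [tensorForm, Finset.smul_sum, smul_smul]

/-- The action of a tuple of matrices on vectors in `⨂ ℂ²`. -/
def hAct {k : ℕ} (h : Fin k → Matrix (Fin 2) (Fin 2) ℂ) (z : Idx k → ℂ) : Idx k → ℂ :=
  fun I => ∑ J, (∏ j, h j (I j) (J j)) * z J

/-- The action of a tuple of matrices on tensors of coefficients. -/
def kernelTensor {k : ℕ} (h : Fin k → Matrix (Fin 2) (Fin 2) ℂ) (t : (Fin k → Site) → ℂ) :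
    (Fin k → Site) → ℂ :=
  fun δ => ∑ γ, t γ * ∏ j, siteKernel (h j) (γ j) (δ j)

theorem tensorForm_hAct {k : ℕ} (h : Fin k → Matrix (Fin 2) (Fin 2) ℂ) (t : (Fin k → Site) → ℂ)
    (y : Fin 4 → Idx k → ℂ) :
    tensorForm t (fun r => hAct h (y r)) = tensorForm (kernelTensor h t) y := by
  simp only [tensorForm, hAct, kernelTensor, smul_eq_mul, Finset.sum_mul]
  rw [Finset.sum_comm]
  refine Finset.sum_congr rfl fun γ _ => ?_
  rw [Finset.prod_univ_sum, Fintype.piFinset_univ, Finset.mul_sum]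
  refine Fintype.sum_equiv (Equiv.piComm _) _ _ fun δ => ?_
  rw [Finset.prod_mul_distrib, Finset.prod_comm, ← mul_assoc]
  rfl

theorem kernelTensor_eq_self {k : ℕ} {h : Fin k → Matrix (Fin 2) (Fin 2) ℂ}
    (hh : ∀ j, (h j).det = 1) {t : (Fin k → Site) → ℂ} (ht : t ∈ sliceSpace k) :
    kernelTensor h t = t := by
  obtain ⟨s, rfl⟩ := ht
  funext δ
  simp only [kernelTensor, wordTensor_apply, Finset.sum_mul]
  rw [Finset.sum_comm]
  refine Finset.sum_congr rfl fun σ _ => ?_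
  simp_rw [mul_assoc, ← Finset.prod_mul_distrib, ← Finset.mul_sum]
  rw [← Fintype.piFinset_univ, ← Finset.prod_univ_sum (fun _ => Finset.univ)
    (fun j α => pm (σ j) α * siteKernel (h j) α (δ j))]
  simp_rw [sum_pm_mul_siteKernel (hh _)]

theorem permTensor_kernelTensor {k : ℕ} (π : Equiv.Perm (Fin 4))
    (h : Fin k → Matrix (Fin 2) (Fin 2) ℂ) (t : (Fin k → Site) → ℂ) :
    permTensor π (kernelTensor h t) = kernelTensor h (permTensor π t) := by
  funext δ
  refine (Fintype.sum_equiv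
    (Equiv.arrowCongr (Equiv.refl _) (Equiv.arrowCongr π.symm (Equiv.refl _))) _ _ fun γ => ?_).symm
  have : ∀ (A : Matrix (Fin 2) (Fin 2) ℂ) (α β : Site),
      siteKernel A (α ∘ π) (β ∘ π) = siteKernel A α β := fun A α β =>
    Equiv.prod_comp π fun r => A (α r) (β r)
  simp [Equiv.arrowCongr, permTensor, ← this _ (γ _)]
  exact Or.inl rfl

/-! ### LSUT invariants as multilinear forms -/

/-- Two families of variables on which `SU(2)^k` acts in the same way. -/
def twistedVar {k : ℕ} (τ : Fin 2) : Idx k → MixedPoly k :=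
  if τ = 0 then fun I => X (Sum.inl I) else dualVec fun I => X (Sum.inr I)

/-- The values of the twisted variables. -/
def twistedVal {k : ℕ} (a : Idx k → ℂ) (τ : Fin 2) : Idx k → ℂ :=
  if τ = 0 then a else dualVec fun I => starRingEnd ℂ (a I)

/-- The polynomial obtained from a multilinear form by filling in components or conjugated
components according to the type `τ`. -/
def formPoly {k : ℕ} (τ : Site) (t : (Fin k → Site) → ℂ) : MixedPoly k :=
  tensorForm t fun r => twistedVar (τ r)

theorem evalConj_formPoly {k : ℕ} (a : Idx k → ℂ) (τ : Site) (t : (Fin k → Site) → ℂ) :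
    evalConj a (formPoly τ t) = tensorForm t fun r => twistedVal a (τ r) := by
  have := map_tensorForm (aeval (R := ℂ) (Sum.elim a fun I => starRingEnd ℂ (a I))) t
    fun r => twistedVar (τ r)
  rw [evalConj, formPoly, ← coe_aeval_eq_eval]
  refine this.trans (congrArg _ ?_)
  funext r I
  rw [twistedVar, twistedVal]
  split_ifs <;> simp [dualVec]

theorem formPoly_permTensor {k : ℕ} (π : Equiv.Perm (Fin 4)) (τ : Site)
    (t : (Fin k → Site) → ℂ) : formPoly τ (permTensor π t) = formPoly (τ ∘ π) t :=
  tensorForm_permTensor π t _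

/-- For a `2 × 2` matrix of determinant 1, conjugation by the symplectic form is the inverse
transpose. -/
theorem dualVec_hAct {k : ℕ} {h : Fin k → Matrix (Fin 2) (Fin 2) ℂ} (hh : ∀ j, (h j).det = 1)
    (z : Idx k → ℂ) : dualVec (hAct h z) = hAct (fun j => (h j)⁻¹.transpose) (dualVec z) := by
  funext I
  simp only [dualVec, hAct, smul_eq_mul, Matrix.transpose_apply, Finset.mul_sum]
  refine Fintype.sum_equiv (Equiv.arrowCongr (Equiv.refl _) Fin.revPerm) _ _ fun J => ?_
  have e1 : (Equiv.arrowCongr (Equiv.refl _) Fin.revPerm) J = flipIdx J := by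
    funext j
    simp [Equiv.arrowCongr, flipIdx]
  rw [e1, flipIdx_flipIdx, ← mul_assoc, ← mul_assoc]
  congr 1
  rw [sgnIdx, sgnIdx, ← Finset.prod_mul_distrib, ← Finset.prod_mul_distrib]
  refine Finset.prod_congr rfl fun j _ => ?_
  have h4 : (h j)⁻¹ = (h j).adjugate := by
    rw [Matrix.inv_def, hh]
    simp
  simp only [flipIdx]
  rw [h4, Matrix.adjugate_fin_two]
  generalize I j = x
  generalize J j = y
  fin_cases x <;> fin_cases y <;> simp

/-- The components transform by inverses of unitary matrices, that is, by conjugate transposes;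
conjugating leaves `g` itself. -/
theorem conj_act {k : ℕ} (g : Fin k → Matrix.specialUnitaryGroup (Fin 2) ℂ) (a : Idx k → ℂ) :
    (fun I => starRingEnd ℂ (act (fun j => (g j : Matrix (Fin 2) (Fin 2) ℂ)) a I)) =
      hAct (fun j => (g j : Matrix (Fin 2) (Fin 2) ℂ)) fun I => starRingEnd ℂ (a I) := by
  have h : ∀ j x y, starRingEnd ℂ ((g j : Matrix (Fin 2) (Fin 2) ℂ)⁻¹ x y) =
      (g j : Matrix (Fin 2) (Fin 2) ℂ) y x := fun j x y => by
    rw [Matrix.inv_eq_right_inv (Matrix.mem_unitaryGroup_iff.1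
      (Matrix.mem_specialUnitaryGroup_iff.1 (g j).2).1), Matrix.star_apply]
    simp
  funext I
  simp only [act, hAct, map_sum, map_mul, map_prod, h]

theorem det_specialUnitary (g : Matrix.specialUnitaryGroup (Fin 2) ℂ) :
    (g : Matrix (Fin 2) (Fin 2) ℂ).det = 1 :=
  (Matrix.mem_specialUnitaryGroup_iff.1 g.2).2

theorem twistedVal_act {k : ℕ} (g : Fin k → Matrix.specialUnitaryGroup (Fin 2) ℂ)
    (a : Idx k → ℂ) (τ : Fin 2) :
    twistedVal (act (fun j => (g j : Matrix (Fin 2) (Fin 2) ℂ)) a) τ =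
      hAct (fun j => (g j : Matrix (Fin 2) (Fin 2) ℂ)⁻¹.transpose) (twistedVal a τ) := by
  rw [twistedVal, twistedVal]
  split_ifs with h
  · rfl
  · rw [conj_act, dualVec_hAct fun j => det_specialUnitary (g j)]

theorem det_inv_transpose {g : Matrix (Fin 2) (Fin 2) ℂ} (hg : g.det = 1) :
    g⁻¹.transpose.det = 1 := by
  rw [Matrix.det_transpose, Matrix.det_nonsing_inv, hg]
  simp

theorem formPoly_mem_lsutInvariants {k : ℕ} (τ : Site) {t : (Fin k → Site) → ℂ}
    (ht : t ∈ sliceSpace k) : formPoly τ t ∈ lsutInvariants k 4 := by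
  constructor
  · refine (homogeneousSubmodule _ ℂ 4).sum_mem fun γ _ =>
      (homogeneousSubmodule _ ℂ 4).smul_mem _ ?_
    have := IsHomogeneous.prod Finset.univ
      (fun r : Fin 4 => twistedVar (τ r) (fun j => γ j r)) (fun _ => 1) fun r _ => by
        rw [twistedVar]
        split_ifs
        · exact isHomogeneous_X _ _
        · exact (homogeneousSubmodule _ ℂ 1).smul_mem _ (isHomogeneous_X _ _)
    simpa using this
  · intro g a
    rw [evalConj_formPoly, evalConj_formPoly]
    simp_rw [twistedVal_act]
    rw [tensorForm_hAct,
      kernelTensor_eq_self (fun j => det_inv_transpose (det_specialUnitary (g j))) ht]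

/-! ### Existence and uniqueness of the tensors of a polynomial -/

/-- The substitution of the twisted variables. -/
def twist (k : ℕ) : MvPolynomial (Fin 2 × Idx k) ℂ →ₐ[ℂ] MixedPoly k :=
  aeval fun p => twistedVar p.1 p.2

/-- The inverse of `twist`. -/
def untwist (k : ℕ) : MixedPoly k →ₐ[ℂ] MvPolynomial (Fin 2 × Idx k) ℂ :=
  -- Applying `dualVec` twice multiplies by `sgnIdx I * sgnIdx (flipIdx I) = (-1)^k`; the extra
  -- factors compensate for this sign.
  aeval (Sum.elim (fun I => X (0, I)) (dualVec fun I => sgnIdx I • sgnIdx (flipIdx I) • X (1, I)))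

theorem twist_untwist {k : ℕ} (P : MixedPoly k) : twist k (untwist k P) = P := by
  have : (twist k).comp (untwist k) = AlgHom.id ℂ _ := by
    ext v : 1
    rcases v with I | I
    · simp [twist, untwist, twistedVar]
    · have h : sgnIdx I * (sgnIdx (flipIdx I) * (sgnIdx I * sgnIdx (flipIdx I))) = 1 := by
        linear_combination sgnIdx (flipIdx I) * sgnIdx (flipIdx I) * sgnIdx_mul_self I +
          sgnIdx_mul_self (flipIdx I)
      simp [twist, untwist, twistedVar, dualVec, smul_smul, mul_assoc, h]
  exact DFunLike.congr_fun this P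

theorem untwist_twist {k : ℕ} (P : MvPolynomial (Fin 2 × Idx k) ℂ) :
    untwist k (twist k P) = P := by
  have : (untwist k).comp (twist k) = AlgHom.id ℂ _ := by
    ext v : 1
    obtain ⟨τ, I⟩ := v
    fin_cases τ
    · simp [twist, untwist, twistedVar]
    · have h : sgnIdx I * (sgnIdx (flipIdx I) * (sgnIdx I * sgnIdx (flipIdx I))) = 1 := by
        linear_combination sgnIdx (flipIdx I) * sgnIdx (flipIdx I) * sgnIdx_mul_self I +
          sgnIdx_mul_self (flipIdx I)
      simp [twist, untwist, twistedVar, dualVec, smul_smul, h]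
  exact DFunLike.congr_fun this P

theorem isHomogeneous_untwist {k n : ℕ} {P : MixedPoly k} (hP : P.IsHomogeneous n) :
    (untwist k P).IsHomogeneous n := by
  have := hP.aeval (Sum.elim (fun I => X (0, I))
    (dualVec fun I => sgnIdx I • sgnIdx (flipIdx I) • X (1, I)) :
      Idx k ⊕ Idx k → MvPolynomial (Fin 2 × Idx k) ℂ) (n := 1) fun v => by
    rcases v with I | I
    · exact isHomogeneous_X _ _
    · exact (homogeneousSubmodule _ ℂ 1).smul_mem _ ((homogeneousSubmodule _ ℂ 1).smul_mem _
        ((homogeneousSubmodule _ ℂ 1).smul_mem _ (isHomogeneous_X _ _)))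
  rwa [one_mul] at this

/-- A tensor of coefficients for all types as one tensor. -/
def totalTensor {k : ℕ} (T : Site → (Fin k → Site) → ℂ) : (Fin 4 → Fin 2 × Idx k) → ℂ :=
  fun I => T (fun r => (I r).1) fun j r => (I r).2 j

/-- Multi-indices of total tensors. -/
def totalEquiv (k : ℕ) : (Fin 4 → Fin 2 × Idx k) ≃ Site × (Fin k → Site) where
  toFun I := (fun r => (I r).1, fun j r => (I r).2 j)
  invFun p r := (p.1 r, fun j => p.2 j r)

theorem twist_tensorPoly {k : ℕ} (T : Site → (Fin k → Site) → ℂ) :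
    twist k (tensorPoly (totalTensor T)) = ∑ τ, formPoly τ (T τ) := by
  rw [tensorPoly_apply, map_sum, ← (totalEquiv k).symm.sum_comp, Fintype.sum_prod_type]
  refine Finset.sum_congr rfl fun τ _ => Finset.sum_congr rfl fun γ _ => ?_
  rw [map_smul, map_prod]
  simp [twist, totalTensor, totalEquiv]

theorem exists_sum_formPoly_eq {k : ℕ} {P : MixedPoly k} (hP : P.IsHomogeneous 4) :
    ∃ T : Site → (Fin k → Site) → ℂ, (∀ π τ, permTensor π (T (τ ∘ π)) = T τ) ∧
      P = ∑ τ, formPoly τ (T τ) := by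
  obtain ⟨t, ht, h⟩ := exists_tensorPoly_eq (isHomogeneous_untwist hP)
  refine ⟨fun τ γ => t ((totalEquiv k).symm (τ, γ)), fun π τ => ?_, ?_⟩
  · funext γ
    exact ht π ((totalEquiv k).symm (τ, γ))
  · rw [← twist_tensorPoly, ← twist_untwist P, ← h]
    rfl

theorem sum_permTensor_eq_zero {k : ℕ} {T : Site → (Fin k → Site) → ℂ}
    (h : ∑ τ, formPoly τ (T τ) = 0) (τ : Site) :
    ∑ π : Equiv.Perm (Fin 4), permTensor π (T (τ ∘ π)) = 0 := by
  rw [← twist_tensorPoly] at h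
  have h2 : tensorPoly (totalTensor T) = 0 := by
    rw [← untwist_twist (tensorPoly (totalTensor T)), h, map_zero]
  funext γ
  rw [Finset.sum_apply]
  exact sum_perm_eq_zero h2 ((totalEquiv k).symm (τ, γ))

/-! ### From invariant polynomials to invariant tensors -/

theorem conj_mem_specialUnitaryGroup {h : Matrix (Fin 2) (Fin 2) ℂ}
    (hh : h ∈ Matrix.specialUnitaryGroup (Fin 2) ℂ) :
    ∃ g : Matrix.specialUnitaryGroup (Fin 2) ℂ,
      (g : Matrix (Fin 2) (Fin 2) ℂ)⁻¹.transpose = h := by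
  obtain ⟨h1, h2⟩ := Matrix.mem_specialUnitaryGroup_iff.1 hh
  have h3 := Matrix.mem_unitaryGroup_iff.1 h1
  have h4 : (h.map (starRingEnd ℂ)) * h.transpose = 1 := by
    have := congrArg (fun M : Matrix (Fin 2) (Fin 2) ℂ => M.map (starRingEnd ℂ)) h3
    simp only [Matrix.map_mul] at this
    convert this using 1
    · congr 1
      ext i j
      simp [Matrix.star_apply]
    · simp
  refine ⟨⟨h.map (starRingEnd ℂ), Matrix.mem_specialUnitaryGroup_iff.2
    ⟨Matrix.mem_unitaryGroup_iff.2 ?_, ?_⟩⟩, ?_⟩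
  · convert h4 using 2
    ext i j
    simp [Matrix.star_apply]
  · have := RingHom.map_det (starRingEnd ℂ) h
    rw [h2, map_one] at this
    exact this.symm
  · rw [Matrix.inv_eq_right_inv h4, Matrix.transpose_transpose]

theorem mem_sliceSpace_of_kernelTensor {k : ℕ} {t : (Fin k → Site) → ℂ}
    (ht : ∀ h : Fin k → Matrix (Fin 2) (Fin 2) ℂ,
      (∀ j, h j ∈ Matrix.specialUnitaryGroup (Fin 2) ℂ) → kernelTensor h t = t) :
    t ∈ sliceSpace k := by
  rw [mem_sliceSpace]
  intro γ j
  set w : Site → ℂ := fun α => t (Function.update γ j α) with hw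
  refine ⟨![-w ![0, 0, 1, 1] / 2, w ![0, 1, 0, 1] + w ![0, 0, 1, 1] / 2], fun α => ?_⟩
  rw [Fin.sum_univ_two]
  refine eq_sum_pm (w := w) (fun h hh β => ?_) α
  have h1 := congrFun (ht (Function.update 1 j h) fun i => by
    by_cases hi : i = j
    · subst hi
      rwa [Function.update_self]
    · rw [Function.update_of_ne hi]
      exact one_mem _) (Function.update γ j β)
  rw [hw]
  refine Eq.trans ?_ h1
  have one_kernel : ∀ α β : Site, siteKernel 1 α β = if α = β then 1 else 0 := by
    intro α β
    split_ifs with h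
    · subst h
      simp [siteKernel]
    · obtain ⟨r, hr⟩ := Function.ne_iff.1 h
      exact Finset.prod_eq_zero (Finset.mem_univ r) (Matrix.one_apply_ne hr)
  -- The identity matrices at the sites other than `j` have delta kernels, so only the updates of
  -- `γ` at `j` contribute.
  refine Fintype.sum_of_injective _ (Function.update_injective γ j) _ _ (fun δ hδ => ?_)
    fun α => ?_
  · obtain ⟨i, hi, hne⟩ : ∃ i, i ≠ j ∧ δ i ≠ γ i := by
      by_contra! hcon
      refine hδ ⟨δ j, ?_⟩
      funext i
      by_cases hi : i = j
      · subst hi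
        rw [Function.update_self]
      · rw [Function.update_of_ne hi, hcon i hi]
    refine mul_eq_zero_of_right _ (Finset.prod_eq_zero (Finset.mem_univ i) ?_)
    rw [Function.update_of_ne hi, Function.update_of_ne hi]
    exact (one_kernel _ _).trans (if_neg hne)
  · congr 1
    rw [Finset.prod_eq_single j]
    · simp
    · intro i _ hi
      rw [Function.update_of_ne hi, Function.update_of_ne hi, Function.update_of_ne hi]
      exact (one_kernel _ _).trans (if_pos rfl)
    · simp

/-- The group action commutes with `S_4`, so the differences of transformed and original tensors are
again equivariant. They represent the zero polynomial, and for an equivariant family the sum over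
`S_4` is 24 times each member, which must vanish. -/
theorem exists_of_mem_lsutInvariants {k : ℕ} {P : MixedPoly k} (hP : P ∈ lsutInvariants k 4) :
    ∃ T : Site → (Fin k → Site) → ℂ, (∀ π τ, permTensor π (T (τ ∘ π)) = T τ) ∧
      (∀ τ, T τ ∈ sliceSpace k) ∧ P = ∑ τ, formPoly τ (T τ) := by
  obtain ⟨T, hT, rfl⟩ := exists_sum_formPoly_eq hP.1
  refine ⟨T, hT, fun τ => mem_sliceSpace_of_kernelTensor fun h hh => ?_, rfl⟩
  choose g hg using fun j => conj_mem_specialUnitaryGroup (hh j)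
  have e : ∀ a t (τ : Site), evalConj (act (fun j => (g j : Matrix (Fin 2) (Fin 2) ℂ)) a)
      (formPoly τ t) = evalConj a (formPoly τ (kernelTensor h t)) := by
    intro a t τ
    simp_rw [evalConj_formPoly, twistedVal_act, hg]
    rw [tensorForm_hAct]
  have h1 : ∑ τ, formPoly τ (kernelTensor h (T τ)) = ∑ τ, formPoly τ (T τ) := by
    refine eq_of_evalConj_eq fun a => ?_
    rw [← hP.2 g a]
    simp only [evalConj, map_sum] at e ⊢
    simp_rw [e]
  have h2 : ∑ τ, formPoly τ (kernelTensor h (T τ) - T τ) = 0 := by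
    rw [← sub_eq_zero, ← Finset.sum_sub_distrib] at h1
    rw [← h1]
    refine Finset.sum_congr rfl fun τ _ => ?_
    simp [formPoly, tensorForm, sub_smul]
  have h3 := sum_permTensor_eq_zero h2 τ
  have h4 : ∀ π : Equiv.Perm (Fin 4), permTensor π (kernelTensor h (T (τ ∘ π)) - T (τ ∘ π)) =
      kernelTensor h (T τ) - T τ := by
    intro π
    have := permTensor_kernelTensor π h (T (τ ∘ π))
    rw [hT] at this
    rw [← this, ← congrArg (permTensor π _ - ·) (hT π τ)]
    rfl
  simp_rw [h4] at h3
  rw [Finset.sum_const, smul_eq_zero_iff_right (by simp)] at h3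
  exact sub_eq_zero.1 h3

/-! ### The dimension of the space of LSUT invariants of degree four -/

/-- The LSUT invariant with given invariant multilinear forms of the sorted types. -/
def sumFormPoly (k : ℕ) : ((q : Fin 5) → stabSpace k q) →ₗ[ℂ] MixedPoly k where
  toFun t := ∑ q, formPoly (sortedType q) (t q).1
  map_add' s t := by
    rw [← Finset.sum_add_distrib]
    exact Finset.sum_congr rfl fun q _ => tensorForm_add _ _ _
  map_smul' c t := by
    rw [Finset.smul_sum]
    exact Finset.sum_congr rfl fun q _ => tensorForm_smul _ _ _

/-- Distinct sorted types lie in distinct `S_4`-orbits. In the sum over `S_4` at `sortedType q` only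
the stabilizer contributes, and each of its elements contributes the same tensor. -/
theorem sumFormPoly_injective (k : ℕ) : Function.Injective (sumFormPoly k) := by
  rw [injective_iff_map_eq_zero]
  intro t ht
  have inj : ∀ (π : Equiv.Perm (Fin 4)) (q q' : Fin 5),
      sortedType q ∘ π = sortedType q' → q = q' := by decide
  have inj' : ∀ {q q' : Fin 5}, sortedType q = sortedType q' → q = q' := fun h => inj 1 _ _ h
  have h1 : ∑ τ, formPoly τ (∑ q, if τ = sortedType q then (t q).1 else 0) = 0 := by
    rw [← ht]
    have e : ∀ q, (∑ q', if sortedType q = sortedType q' then (t q').1 else 0) = (t q).1 := by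
      intro q
      rw [Finset.sum_eq_single q, if_pos rfl]
      · exact fun q' _ h => if_neg fun h' => h (inj' h').symm
      · simp
    refine (Fintype.sum_of_injective sortedType (fun _ _ => inj') _ _ (fun τ hτ => ?_)
      fun q => ?_).symm
    · rw [Finset.sum_eq_zero]
      · simp [formPoly, tensorForm]
      · exact fun q _ => if_neg fun h => hτ ⟨q, h.symm⟩
    · rw [e]
  funext q
  have h2 := sum_permTensor_eq_zero h1 (sortedType q)
  have h3 : ∀ π : Equiv.Perm (Fin 4),
      permTensor π (∑ q', if sortedType q ∘ π = sortedType q' then (t q').1 else 0) =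
        if sortedType q ∘ π = sortedType q then (t q).1 else 0 := by
    intro π
    split_ifs with h
    · rw [h, Finset.sum_eq_single q, if_pos rfl, (t q).2.2 π h]
      · exact fun q' _ h' => if_neg fun h'' => h' (inj' h'').symm
      · simp
    · rw [Finset.sum_eq_zero]
      · rfl
      · refine fun q' _ => if_neg fun h' => h ?_
        rw [h', inj π q q' h']
  simp_rw [h3] at h2
  rw [← Finset.sum_filter, Finset.sum_const, smul_eq_zero] at h2
  refine Subtype.ext (h2.resolve_left (Finset.card_ne_zero.2 ⟨1, by simp⟩))

theorem range_sumFormPoly (k : ℕ) : LinearMap.range (sumFormPoly k) = lsutInvariants k 4 := by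
  refine le_antisymm ?_ fun P hP => ?_
  · rintro _ ⟨t, rfl⟩
    exact Submodule.sum_mem _ fun q _ => formPoly_mem_lsutInvariants _ (t q).2.1
  · obtain ⟨T, hT, hs, rfl⟩ := exists_of_mem_lsutInvariants hP
    have d : ∀ τ : Site, ∃ q, ∃ π : Equiv.Perm (Fin 4), τ ∘ π = sortedType q := by decide
    choose q π hq using d
    have e : ∀ τ, formPoly τ (T τ) = formPoly (sortedType (q τ)) (T (sortedType (q τ))) := by
      intro τ
      rw [← hT (π τ) τ, formPoly_permTensor, hq]
    have hmem : ∀ p, T (sortedType p) ∈ stabSpace k p := fun p => ⟨hs _, fun ρ hρ => by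
      nth_rewrite 2 [← hT ρ]
      rw [hρ]⟩
    -- All types in one orbit give the same polynomial, so the orbit size appears as a factor.
    refine ⟨fun p => ((Finset.univ.filter fun τ => q τ = p).card : ℂ) •
      ⟨T (sortedType p), hmem p⟩, ?_⟩
    rw [Finset.sum_congr rfl fun τ _ => e τ, ← Finset.sum_fiberwise (s := Finset.univ) q]
    change ∑ p, formPoly (sortedType p)
      (((Finset.univ.filter fun τ => q τ = p).card : ℂ) • T (sortedType p)) = _
    refine Finset.sum_congr rfl fun p _ => ?_
    rw [Finset.sum_congr rfl (g := fun _ => formPoly (sortedType p) (T (sortedType p)))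
      fun τ hτ => by rw [(Finset.mem_filter.1 hτ).2], Finset.sum_const,
      ← Nat.cast_smul_eq_nsmul ℂ]
    exact tensorForm_smul _ _ _

theorem finrank_lsutInvariants (n : ℕ) :
    (Module.finrank ℂ (lsutInvariants (n + 1) 4) : ℚ) = 7 / 3 * 2 ^ n - 4 / 3 * (-1) ^ n := by
  rw [← range_sumFormPoly, LinearMap.finrank_range_of_inj (sumFormPoly_injective _),
    Module.finrank_pi_fintype, Fin.sum_univ_five, finrank_stabSpace_two]
  push_cast
  have h := fun (q : Fin 5) (hq : q ≠ 2) => finrank_stabSpace n hq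
  linear_combination (h 0 (by decide) + h 1 (by decide) + h 3 (by decide) + h 4 (by decide)) / 3

/-! ### SLOCC invariants of degree four -/

theorem ofHol_mem_lsutInvariants {k : ℕ} {P : HolPoly k} (hP : P ∈ sloccInvariants k 4) :
    ofHol P ∈ lsutInvariants k 4 := by
  refine ⟨hP.1.rename_isHomogeneous, fun g a => ?_⟩
  have e : ∀ a, evalConj a (ofHol P) = eval a P := fun a => by
    rw [evalConj, ofHol, eval_rename]
    rfl
  rw [e, e]
  exact hP.2 (fun j => ⟨g j, det_specialUnitary (g j)⟩) a

/-- Tensors in `sliceSpace k` are fixed by all matrices of determinant 1, not only by unitary ones.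
-/
theorem exists_ofHol_eq {k : ℕ} {t : (Fin k → Site) → ℂ} (ht : t ∈ sliceSpace k) :
    ∃ P ∈ sloccInvariants k 4, ofHol P = formPoly (sortedType 0) t := by
  refine ⟨tensorForm t fun _ I => X I, ⟨?_, fun g a => ?_⟩, ?_⟩
  · refine (homogeneousSubmodule _ ℂ 4).sum_mem fun γ _ =>
      (homogeneousSubmodule _ ℂ 4).smul_mem _ ?_
    have := IsHomogeneous.prod Finset.univ
      (fun r : Fin 4 => (X fun j => γ j r : HolPoly k)) (fun _ => 1) fun r _ =>
        isHomogeneous_X _ _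
    simpa using this
  · have e : ∀ a, eval a (tensorForm t fun _ I => X I : HolPoly k) = tensorForm t fun _ => a := by
      intro a
      rw [← coe_aeval_eq_eval]
      refine (map_tensorForm (aeval (R := ℂ) a) t _).trans ?_
      simp
    rw [e, e]
    have h := tensorForm_hAct (fun j => (g j : Matrix (Fin 2) (Fin 2) ℂ)⁻¹.transpose) t fun _ => a
    rw [kernelTensor_eq_self (fun j => det_inv_transpose (g j).2) ht] at h
    exact h
  · refine (map_tensorForm (rename (R := ℂ) Sum.inl) t _).trans (congrArg _ ?_)
    funext r I
    simp [twistedVar, sortedType]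

/-! ### Scalar products -/

section ScalarProduct

variable {k : ℕ}

theorem scalarProduct_eq_sum {Φ : FormPoly k} (Ψ : FormPoly k) {s : Finset (Aux k →₀ ℕ)}
    (hs : Φ.support ⊆ s) : scalarProduct Φ Ψ = ∑ m ∈ s,
      (∏ p, (m p).factorial : ℕ) • (ofHol (coeff m Φ) * conj (ofHol (coeff m Ψ))) := by
  refine Finset.sum_subset hs fun m _ hm => ?_
  rw [notMem_support_iff.1 hm]
  simp [ofHol]

theorem scalarProduct_add_left (Φ Φ' Ψ : FormPoly k) :
    scalarProduct (Φ + Φ') Ψ = scalarProduct Φ Ψ + scalarProduct Φ' Ψ := by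
  classical
  rw [scalarProduct_eq_sum Ψ (support_add (p := Φ) (q := Φ')),
    scalarProduct_eq_sum Ψ (Finset.subset_union_left (s₁ := Φ.support) (s₂ := Φ'.support)),
    scalarProduct_eq_sum Ψ (Finset.subset_union_right (s₁ := Φ.support) (s₂ := Φ'.support)),
    ← Finset.sum_add_distrib]
  refine Finset.sum_congr rfl fun m _ => ?_
  simp [ofHol, add_mul]

theorem scalarProduct_smul_left (c : ℂ) (Φ Ψ : FormPoly k) :
    scalarProduct (c • Φ) Ψ = c • scalarProduct Φ Ψ := by
  rw [scalarProduct_eq_sum Ψ (support_smul (a := c) (f := Φ)), scalarProduct, Finset.smul_sum]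
  refine Finset.sum_congr rfl fun m _ => ?_
  rw [smul_comm c, coeff_smul]
  simp [ofHol]

theorem conj_add (P Q : MixedPoly k) : conj (P + Q) = conj P + conj Q := by
  simp [conj]

theorem conj_smul (c : ℂ) (P : MixedPoly k) : conj (c • P) = starRingEnd ℂ c • conj P := by
  simp [conj, smul_eq_C_mul]

theorem conj_conj (P : MixedPoly k) : conj (conj P) = P := by
  rw [conj, conj, map_rename, rename_rename, map_map]
  simp [map_id]

theorem scalarProduct_add_right (Φ Ψ Ψ' : FormPoly k) :
    scalarProduct Φ (Ψ + Ψ') = scalarProduct Φ Ψ + scalarProduct Φ Ψ' := by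
  simp only [scalarProduct, ← Finset.sum_add_distrib]
  refine Finset.sum_congr rfl fun m _ => ?_
  simp [ofHol, conj_add, mul_add]

theorem scalarProduct_sum_sum {ι κ : Type*} (s : Finset ι) (t : Finset κ) (Φ : ι → FormPoly k)
    (Ψ : κ → FormPoly k) : scalarProduct (∑ i ∈ s, Φ i) (∑ l ∈ t, Ψ l) =
      ∑ i ∈ s, ∑ l ∈ t, scalarProduct (Φ i) (Ψ l) := by
  let F : FormPoly k →+ FormPoly k →+ MixedPoly k :=
    AddMonoidHom.mk' (fun Φ => AddMonoidHom.mk' (scalarProduct Φ) (scalarProduct_add_right Φ))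
      fun Φ Φ' => by
        refine AddMonoidHom.ext fun Ψ => ?_
        exact scalarProduct_add_left Φ Φ' Ψ
  have h : F (∑ i ∈ s, Φ i) (∑ l ∈ t, Ψ l) = ∑ i ∈ s, ∑ l ∈ t, F (Φ i) (Ψ l) := by
    simp_rw [map_sum, AddMonoidHom.finsetSum_apply]
    exact Finset.sum_comm
  exact h

theorem scalarProduct_monomial [DecidableEq (Aux k →₀ ℕ)] (m n : Aux k →₀ ℕ) (c c' : HolPoly k) :
    scalarProduct (monomial m c) (monomial n c') =
      if n = m then (∏ p, (m p).factorial : ℕ) • (ofHol c * conj (ofHol c')) else 0 := by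
  rw [scalarProduct_eq_sum _ (support_monomial_subset (s := m)), Finset.sum_singleton,
    coeff_monomial, if_pos rfl, coeff_monomial]
  split_ifs
  · rfl
  · simp [ofHol, conj]

end ScalarProduct

/-! ### Multilinear forms in the auxiliary variables -/

section LinForm

variable {k : ℕ}

/-- The exponent of the monomial `∏ j, x^{(j)}_{J j}`. -/
def linExpo (J : Idx k) : Aux k →₀ ℕ := ∑ j, Finsupp.single (j, J j) 1

theorem linExpo_apply (J : Idx k) (p : Aux k) : linExpo J p = if J p.1 = p.2 then 1 else 0 := by
  classical
  obtain ⟨j, b⟩ := p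
  rw [linExpo, Finsupp.finsetSum_apply, Finset.sum_eq_single j]
  · simp [Finsupp.single_apply]
  · intro i _ hi
    simp [hi]
  · simp

theorem linExpo_injective : Function.Injective (linExpo (k := k)) := fun I J h => by
  funext j
  have := DFunLike.congr_fun h (j, J j)
  rw [linExpo_apply, linExpo_apply] at this
  simpa using this

theorem prod_X_eq_monomial_linExpo (J : Idx k) :
    ∏ j, (X (j, J j) : FormPoly k) = monomial (linExpo J) 1 := by
  rw [linExpo, monomial_sum_one]
  rfl

/-- The multilinear form with coefficients `c`. -/
def linForm (c : Idx k → HolPoly k) : FormPoly k := ∑ J, C (c J) * ∏ j, X (j, J j)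

theorem linForm_eq_sum_monomial (c : Idx k → HolPoly k) :
    linForm c = ∑ J, monomial (linExpo J) (c J) := by
  simp [linForm, prod_X_eq_monomial_linExpo, C_mul_monomial]

theorem groundForm_eq_linForm : groundForm k = linForm X := rfl

theorem scalarProduct_linForm_groundForm (c : Idx k → HolPoly k) :
    scalarProduct (linForm c) (groundForm k) = ∑ J, ofHol (c J) * X (Sum.inr J) := by
  classical
  rw [groundForm_eq_linForm, linForm_eq_sum_monomial, linForm_eq_sum_monomial,
    scalarProduct_sum_sum]
  refine Finset.sum_congr rfl fun J _ => ?_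
  simp_rw [scalarProduct_monomial, linExpo_injective.eq_iff]
  rw [Finset.sum_ite_eq' Finset.univ J, if_pos (Finset.mem_univ J), Finset.prod_eq_one, one_smul]
  · simp [ofHol, conj]
  · intro p _
    rw [linExpo_apply]
    split_ifs <;> simp

theorem evalForm_linForm (a : Idx k → ℂ) (x : Aux k → ℂ) (c : Idx k → HolPoly k) :
    evalForm a x (linForm c) = ∑ J, eval a (c J) * ∏ j, x (j, J j) := by
  simp [evalForm, linForm]

theorem isHomogeneous_coeff_linForm {n : ℕ} {c : Idx k → HolPoly k}
    (hc : ∀ J, (c J).IsHomogeneous n) (m : Aux k →₀ ℕ) :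
    (coeff m (linForm c)).IsHomogeneous n := by
  classical
  rw [linForm_eq_sum_monomial, coeff_sum]
  refine (homogeneousSubmodule _ ℂ n).sum_mem fun J _ => ?_
  rw [coeff_monomial]
  split_ifs
  · exact hc J
  · exact zero_mem _

theorem weight_linExpo (J : Idx k) : Finsupp.weight (auxWeight k) (linExpo J) = fun _ => 1 := by
  classical
  simp only [linExpo, map_sum, Finsupp.weight_single, auxWeight, one_smul]
  exact (Finset.univ_sum_single (fun _ : Fin k => (1 : ℕ)))

theorem isWeightedHomogeneous_linForm (c : Idx k → HolPoly k) :
    IsWeightedHomogeneous (auxWeight k) (linForm c) fun _ => 1 := by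
  rw [linForm_eq_sum_monomial]
  exact (weightedHomogeneousSubmodule _ _ _).sum_mem fun J _ =>
    isWeightedHomogeneous_monomial _ _ _ (weight_linExpo J)

theorem exists_linExpo_eq {m : Aux k →₀ ℕ}
    (hm : Finsupp.weight (auxWeight k) m = fun _ => 1) : ∃ J, linExpo J = m := by
  classical
  have h1 : ∀ j, m (j, 0) + m (j, 1) = 1 := by
    intro j
    have := congrFun hm j
    rw [Finsupp.weight_apply, Finsupp.sum_fintype _ _ (by simp), Finset.sum_apply,
      Fintype.sum_prod_type, Finset.sum_eq_single j] at this
    · simpa [auxWeight] using this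
    · intro i _ hi
      simp [auxWeight, hi.symm]
    · simp
  refine ⟨fun j => if m (j, 0) = 1 then 0 else 1, ?_⟩
  ext ⟨j, b⟩
  rw [linExpo_apply]
  have h2 : m (j, 0) = 1 ∧ m (j, 1) = 0 ∨ m (j, 0) = 0 ∧ m (j, 1) = 1 := by
    have := h1 j
    omega
  obtain ⟨h, h'⟩ | ⟨h, h'⟩ := h2 <;> fin_cases b <;> simp [h, h']

theorem exists_eq_linForm {n : ℕ} {Φ : FormPoly k} (hΦ : Φ ∈ covariants k n fun _ => 1) :
    ∃ c : Idx k → HolPoly k, (∀ J, (c J).IsHomogeneous n) ∧ Φ = linForm c := by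
  classical
  refine ⟨fun J => coeff (linExpo J) Φ, fun J => hΦ.1 _, ?_⟩
  ext1 m
  rw [linForm_eq_sum_monomial, coeff_sum]
  simp_rw [coeff_monomial]
  by_cases h : ∃ J, linExpo J = m
  · obtain ⟨J, rfl⟩ := h
    simp [linExpo_injective.eq_iff]
  · rw [Finset.sum_eq_zero fun J _ => if_neg fun h' => h ⟨J, h'⟩]
    by_contra h0
    exact h (exists_linExpo_eq (hΦ.2.1 h0))

/-! ### Covariants of degree three -/

theorem scalarProduct_groundForm_mem_lsutInvariants {Φ : FormPoly k}
    (hΦ : Φ ∈ covariants k 3 fun _ => 1) :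
    scalarProduct Φ (groundForm k) ∈ lsutInvariants k 4 := by
  obtain ⟨c, hc, rfl⟩ := exists_eq_linForm hΦ
  rw [scalarProduct_linForm_groundForm]
  constructor
  · refine (homogeneousSubmodule _ ℂ 4).sum_mem fun J _ => ?_
    exact ((hc J).rename_isHomogeneous).mul (isHomogeneous_X _ _)
  · intro g a
    have e : ∀ a, evalConj a (∑ J, ofHol (c J) * X (Sum.inr J)) =
        ∑ J, eval a (c J) * starRingEnd ℂ (a J) := by
      intro a
      rw [evalConj, map_sum]
      refine Finset.sum_congr rfl fun J _ => ?_
      rw [map_mul, ofHol, eval_rename, eval_X]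
      rfl
    rw [e, e]
    set a' := act (fun j => (g j : Matrix (Fin 2) (Fin 2) ℂ)) a with ha'
    -- Covariance is evaluated at the basis vectors `x^{(j)} = e_{K j}`, which isolates the
    -- coefficient `c K`.
    have h1 : ∀ K, ∑ J, eval a' (c J) * ∏ j, (g j : Matrix (Fin 2) (Fin 2) ℂ) (J j) (K j) =
        eval a (c K) := by
      intro K
      have h := hΦ.2.2 (fun j => ⟨g j, det_specialUnitary (g j)⟩) a
        fun p => if K p.1 = p.2 then 1 else 0
      rw [evalForm_linForm, evalForm_linForm] at h
      have h3 : ∀ J : Idx k, ∏ j, (if K j = J j then (1 : ℂ) else 0) = if K = J then 1 else 0 := by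
        intro J
        split_ifs with h
        · subst h
          simp
        · obtain ⟨j, hj⟩ := Function.ne_iff.1 h
          exact Finset.prod_eq_zero (Finset.mem_univ j) (if_neg hj)
      simp only [h3, actAux, mul_ite, mul_one, mul_zero, Finset.sum_ite_eq, Finset.mem_univ,
        if_true] at h
      exact h
    have h2 : ∀ J, starRingEnd ℂ (a' J) = ∑ K, (∏ j, (g j : Matrix (Fin 2) (Fin 2) ℂ) (J j) (K j)) *
        starRingEnd ℂ (a K) := fun J => congrFun (conj_act g a) J
    simp_rw [h2, Finset.mul_sum]
    rw [Finset.sum_comm]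
    refine Finset.sum_congr rfl fun K _ => ?_
    rw [← h1 K, Finset.sum_mul]
    exact Finset.sum_congr rfl fun J _ => (mul_assoc _ _ _).symm

/-- The arguments `y, y, y` and the dual of `z`. -/
def threeOne {R : Type*} [CommRing R] [Algebra ℂ R] (y z : Idx k → R) (r : Fin 4) : Idx k → R :=
  if sortedType 1 r = 0 then y else dualVec z

theorem tensorForm_threeOne {R : Type*} [CommRing R] [Algebra ℂ R] (t : (Fin k → Site) → ℂ)
    (y z : Idx k → R) :
    tensorForm t (threeOne y z) = ∑ J, tensorForm t (threeOne y (Pi.single J 1)) * z J := by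
  classical
  simp only [tensorForm, Finset.sum_mul]
  rw [Finset.sum_comm]
  refine Finset.sum_congr rfl fun γ _ => ?_
  simp only [Fin.prod_univ_four, threeOne, sortedType]
  simp [dualVec, Pi.single_apply]

/-- The covariant is the form evaluated at `a, a, a` and the dual of `x^{(1)} ⊗ ⋯ ⊗ x^{(k)}`, which
transforms like `a`. Pairing with `f` replaces this product by `ā`. -/
theorem exists_scalarProduct_eq {t : (Fin k → Site) → ℂ} (ht : t ∈ sliceSpace k) :
    ∃ Φ ∈ covariants k 3 (fun _ => 1),
      scalarProduct Φ (groundForm k) = formPoly (sortedType 1) t := by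
  classical
  let c : Idx k → HolPoly k := fun J => tensorForm t (threeOne X (Pi.single J 1))
  have hc : ∀ J a, eval a (c J) = tensorForm t (threeOne a (Pi.single J 1)) := by
    intro J a
    rw [← coe_aeval_eq_eval]
    refine (map_tensorForm (aeval (R := ℂ) a) t _).trans (congrArg _ ?_)
    funext r I
    simp only [threeOne]
    split_ifs
    · simp
    · simp only [dualVec, Pi.single_apply]
      split_ifs <;> simp
  refine ⟨linForm c, ⟨isHomogeneous_coeff_linForm fun J => ?_, isWeightedHomogeneous_linForm c,
    fun g a x => ?_⟩, ?_⟩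
  · refine (homogeneousSubmodule _ ℂ 3).sum_mem fun γ _ =>
      (homogeneousSubmodule _ ℂ 3).smul_mem _ ?_
    have := IsHomogeneous.prod Finset.univ
      (fun r : Fin 4 => threeOne (X : Idx k → HolPoly k) (Pi.single J 1) r fun j => γ j r)
      (fun r => if sortedType 1 r = 0 then 1 else 0) fun r _ => by
        simp only [threeOne]
        split_ifs
        · exact isHomogeneous_X _ _
        · refine (homogeneousSubmodule _ ℂ 0).smul_mem _ ?_
          rw [Pi.single_apply]
          split_ifs
          · exact isHomogeneous_one _ _
          · exact zero_mem _
    exact this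
  · have e : ∀ a x, evalForm a x (linForm c) =
        tensorForm t (threeOne a fun J => ∏ j, x (j, J j)) := by
      intro a x
      rw [evalForm_linForm, tensorForm_threeOne]
      simp_rw [hc]
    rw [e, e]
    have h := tensorForm_hAct (fun j => (g j : Matrix (Fin 2) (Fin 2) ℂ)⁻¹.transpose) t
      (threeOne a fun J => ∏ j, x (j, J j))
    rw [kernelTensor_eq_self (fun j => det_inv_transpose (g j).2) ht] at h
    rw [← h]
    refine congrArg _ (funext fun r => ?_)
    simp only [threeOne]
    split_ifs
    · rfl
    · rw [← dualVec_hAct fun j => (g j).2]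
      refine congrArg _ (funext fun J => ?_)
      simp only [actAux, hAct]
      rw [Finset.prod_univ_sum, Fintype.piFinset_univ]
      exact Finset.sum_congr rfl fun K _ => Finset.prod_mul_distrib
  · rw [scalarProduct_linForm_groundForm]
    have h := tensorForm_threeOne (R := MixedPoly k) t (fun I => X (Sum.inl I))
      fun I => X (Sum.inr I)
    refine Eq.trans (Finset.sum_congr rfl fun J _ => ?_) h.symm
    congr 1
    refine (map_tensorForm (rename (R := ℂ) Sum.inl) t _).trans (congrArg _ ?_)
    funext r I
    simp only [threeOne]
    split_ifs
    · simp
    · simp only [dualVec, Pi.single_apply]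
      split_ifs <;> simp

end LinForm

/-! ### The quadratic covariants -/

section QuadCovariant

variable {k : ℕ}

theorem derivation_prod_eq_zero {R A ι : Type*} [CommRing R] [CommRing A] [Algebra R A]
    (D : Derivation R A A) (s : Finset ι) (G : ι → A) (h : ∀ i ∈ s, D (G i) = 0) :
    D (∏ i ∈ s, G i) = 0 :=
  Finset.prod_induction G (fun x => D x = 0) (fun a b ha hb => by simp [ha, hb])
    D.map_one_eq_zero h

theorem cayleyOmega_mul {j : Fin k} {A : DoubleForm k}
    (hA : ∀ b, pderiv (Sum.inl (j, b)) A = 0 ∧ pderiv (Sum.inr (j, b)) A = 0) (B : DoubleForm k) :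
    cayleyOmega j (A * B) = A * cayleyOmega j B := by
  simp [cayleyOmega, hA]
  ring

/-- The value of the symplectic form on two basis vectors. -/
def eps (x y : Fin 2) : ℤ := ((y : ℕ) : ℤ) - ((x : ℕ) : ℤ)

theorem cayleyOmega_X_mul_X (j : Fin k) (x y : Fin 2) :
    cayleyOmega j (X (Sum.inl (j, x)) * X (Sum.inr (j, y))) = C (C (eps x y : ℂ)) := by
  fin_cases x <;> fin_cases y <;>
    simp [cayleyOmega, pderiv_X, eps]

/-- The `i`-th factor of a partial transvectant. -/
def omegaFactor (I J : Idx k) (p : Prop) [Decidable p] (i : Fin k) : DoubleForm k :=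
  if p then C (C (eps (I i) (J i) : ℂ)) else X (Sum.inl (i, I i)) * X (Sum.inr (i, J i))

theorem pderiv_omegaFactor (I J : Idx k) (p : Prop) [Decidable p] {i j : Fin k} (hij : i ≠ j)
    (b : Fin 2) : pderiv (Sum.inl (j, b)) (omegaFactor I J p i) = 0 ∧
      pderiv (Sum.inr (j, b)) (omegaFactor I J p i) = 0 := by
  rw [omegaFactor]
  split_ifs
  · simp
  · simp [pderiv_X, hij]

/-- Each `Ω_j` acts only on the factor of site `j` and turns it into a value of the symplectic form.
`Nodup` ensures that this factor is still untouched when its turn comes. -/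
theorem prod_cayleyOmega (σ I J : Idx k) (c : HolPoly k) (l : List (Fin k)) (hl : l.Nodup) :
    (l.map fun j => cayleyOmega j ^ (σ j : ℕ)).prod
      (C c * ∏ i, (X (Sum.inl (i, I i)) * X (Sum.inr (i, J i)))) =
        C c * ∏ i, omegaFactor I J (i ∈ l ∧ σ i = 1) i := by
  induction l with
  | nil => simp [omegaFactor]
  | cons j l ih =>
    obtain ⟨hj, hl⟩ := List.nodup_cons.1 hl
    rw [List.map_cons, List.prod_cons, Module.End.mul_apply, ih hl]
    have fin2 : ∀ x : Fin 2, x = 0 ∨ x = 1 := by decide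
    have hne : ∀ i, i ≠ j → omegaFactor I J (i ∈ j :: l ∧ σ i = 1) i =
        omegaFactor I J (i ∈ l ∧ σ i = 1) i := fun i hi => by
      simp [omegaFactor, hi]
    rw [← Finset.mul_prod_erase _ _ (Finset.mem_univ j),
      ← Finset.mul_prod_erase (a := j) _ (fun i => omegaFactor I J (i ∈ j :: l ∧ σ i = 1) i)
        (Finset.mem_univ j),
      Finset.prod_congr rfl fun i hi => hne i (Finset.ne_of_mem_erase hi)]
    obtain h | h := fin2 (σ j)
    · simp [h, omegaFactor, hj]
    · have h0 : omegaFactor I J (j ∈ l ∧ σ j = 1) j =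
          X (Sum.inl (j, I j)) * X (Sum.inr (j, J j)) := by
        simp [omegaFactor, hj]
      have h1 : omegaFactor I J (j ∈ j :: l ∧ σ j = 1) j = C (C (eps (I j) (J j) : ℂ)) := by
        simp [omegaFactor, h]
      rw [h0, h1, h]
      set A := ∏ i ∈ Finset.univ.erase j, omegaFactor I J (i ∈ l ∧ σ i = 1) i with hA
      have hA' : ∀ b, pderiv (Sum.inl (j, b)) (C c * A) = 0 ∧
          pderiv (Sum.inr (j, b)) (C c * A) = 0 := fun b => by
        rw [pderiv_C_mul, pderiv_C_mul, hA, derivation_prod_eq_zero _ _ _ fun i hi =>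
          (pderiv_omegaFactor I J _ (Finset.ne_of_mem_erase hi) b).1,
          derivation_prod_eq_zero _ _ _ fun i hi =>
          (pderiv_omegaFactor I J _ (Finset.ne_of_mem_erase hi) b).2]
        simp
      have h2 := cayleyOmega_mul hA' (X (Sum.inl (j, I j)) * X (Sum.inr (j, J j)))
      rw [cayleyOmega_X_mul_X] at h2
      simp only [Fin.val_one, pow_one]
      rw [mul_comm _ A, ← mul_assoc, h2]
      ring

/-- The exponent of the monomials of a quadratic covariant. -/
def quadExpo (σ I J : Idx k) : Aux k →₀ ℕ :=
  ∑ i, if σ i = 1 then 0 else Finsupp.single (i, I i) 1 + Finsupp.single (i, J i) 1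

/-- The coefficients of a quadratic covariant. -/
def quadCoeff (σ I J : Idx k) : ℂ := ∏ i, if σ i = 1 then (eps (I i) (J i) : ℂ) else 1

/-- The multidegree with entries `2` and `0` at the entries `0` and `1` of `σ`. -/
def wordDegree (σ : Idx k) : Fin k → ℕ := fun j => if σ j = 0 then 2 else 0

theorem quadCovariant_eq (σ : Idx k) : quadCovariant (wordDegree σ) =
    ∑ I, ∑ J, monomial (quadExpo σ I J) (quadCoeff σ I J • (X I * X J : HolPoly k)) := by
  have fin2 : ∀ x : Fin 2, (2 - if x = 0 then 2 else 0) / 2 = (x : ℕ) := by decide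
  have h1 : (rename Sum.inl (groundForm k) * rename Sum.inr (groundForm k) : DoubleForm k) =
      ∑ I : Idx k, ∑ J : Idx k, C (X I * X J) *
        ∏ i, (X (Sum.inl (i, I i)) * X (Sum.inr (i, J i))) := by
    simp only [groundForm, map_sum, map_mul, rename_C, map_prod, rename_X, Finset.sum_mul_sum,
      Finset.prod_mul_distrib]
    exact Finset.sum_congr rfl fun I _ => Finset.sum_congr rfl fun J _ => by ring
  simp only [quadCovariant, transvectant, wordDegree, fin2]
  rw [h1, List.ofFn_eq_map]
  simp only [map_sum]
  refine Finset.sum_congr rfl fun I _ => Finset.sum_congr rfl fun J _ => ?_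
  rw [prod_cayleyOmega σ I J _ _ (List.nodup_finRange k), map_mul, map_prod, rename_C]
  rw [quadExpo, monomial_sum_index, quadCoeff]
  have h2 : ∀ i, rename (Sum.elim id id) (omegaFactor I J (i ∈ List.finRange k ∧ σ i = 1) i) =
      C (C (if σ i = 1 then (eps (I i) (J i) : ℂ) else 1)) * monomial (if σ i = 1 then 0 else
        Finsupp.single (i, I i) 1 + Finsupp.single (i, J i) 1) (1 : HolPoly k) := by
    intro i
    by_cases h : σ i = 1
    · simp [omegaFactor, h]
    · rw [omegaFactor, if_neg (by simp [h]), if_neg h, if_neg h, map_mul, rename_X, rename_X,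
        ← one_mul (1 : HolPoly k), ← monomial_mul]
      simp [X]
  simp_rw [h2]
  rw [Finset.prod_mul_distrib, ← mul_assoc, smul_eq_C_mul]
  simp only [map_mul, map_prod]
  ring

theorem quadExpo_apply (σ I J : Idx k) (i : Fin k) (b : Fin 2) : quadExpo σ I J (i, b) =
    if σ i = 1 then 0 else (if I i = b then 1 else 0) + (if J i = b then 1 else 0) := by
  classical
  rw [quadExpo, Finsupp.finsetSum_apply, Finset.sum_eq_single i]
  · split_ifs <;> simp_all
  · intro j _ hj
    split_ifs <;> simp [hj]
  · simp

/-- The scalar product of products of two variables or brackets at one site. -/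
def siteNorm (x a b c d : Fin 2) : ℤ :=
  if x = 1 then eps a b * eps c d else
    (if a = c ∧ b = d then 1 else 0) + (if a = d ∧ b = c then 1 else 0)

/-- Norm and orthogonality factor over the sites: where no bracket is taken, the product of two
monomials of degree 2 is a `2 × 2` permanent of deltas. -/
theorem quadNorm_eq (σ I J K L : Idx k) [Decidable (quadExpo σ K L = quadExpo σ I J)] :
    (if quadExpo σ K L = quadExpo σ I J then
      ((∏ p, (quadExpo σ I J p).factorial : ℕ) : ℂ) * (quadCoeff σ I J * quadCoeff σ K L) else 0) =
      ∏ i, (siteNorm (σ i) (I i) (J i) (K i) (L i) : ℂ) := by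
  split_ifs with h
  · rw [Fintype.prod_prod_type, Nat.cast_prod, quadCoeff, quadCoeff, ← Finset.prod_mul_distrib,
      ← Finset.prod_mul_distrib]
    refine Finset.prod_congr rfl fun i _ => ?_
    have hb : ∀ b, _ := fun b => DFunLike.congr_fun h (i, b)
    simp only [quadExpo_apply] at hb ⊢
    by_cases hi : σ i = 1
    · simp [hi, siteNorm]
    · simp only [hi, if_false, siteNorm] at hb ⊢
      have d : ∀ a b c d : Fin 2,
          (∀ x, ((if c = x then 1 else 0) + (if d = x then 1 else 0) : ℕ) =
            (if a = x then 1 else 0) + (if b = x then 1 else 0)) →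
          ((∏ x, ((if a = x then 1 else 0) + (if b = x then 1 else 0) : ℕ).factorial : ℕ) : ℤ) =
            (if a = c ∧ b = d then 1 else 0) + (if a = d ∧ b = c then 1 else 0) := by decide
      rw [mul_one, mul_one, ← d _ _ _ _ hb]
      norm_cast
  · obtain ⟨⟨i, b⟩, hb⟩ := DFunLike.ne_iff.1 h
    rw [quadExpo_apply, quadExpo_apply] at hb
    refine (Finset.prod_eq_zero (Finset.mem_univ i) ?_).symm
    by_cases hi : σ i = 1
    · simp [hi] at hb
    · simp only [hi, if_false, siteNorm] at hb ⊢
      have d : ∀ a b c d x : Fin 2,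
          ((if c = x then 1 else 0) + (if d = x then 1 else 0) : ℕ) ≠
            (if a = x then 1 else 0) + (if b = x then 1 else 0) →
          ((if a = c ∧ b = d then 1 else 0) + (if a = d ∧ b = c then 1 else 0) : ℤ) = 0 := by
        decide
      rw [d _ _ _ _ _ hb, Int.cast_zero]

theorem scalarProduct_quadCovariant (σ : Idx k) :
    scalarProduct (quadCovariant (wordDegree σ)) (quadCovariant (wordDegree σ)) =
      ∑ I, ∑ J, ∑ K, ∑ L, (∏ i, (siteNorm (σ i) (I i) (J i) (K i) (L i) : ℂ)) •
        (X (Sum.inl I) * X (Sum.inl J) * X (Sum.inr K) * X (Sum.inr L) : MixedPoly k) := by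
  classical
  rw [quadCovariant_eq]
  simp only [← Fintype.sum_prod_type']
  rw [scalarProduct_sum_sum, Fintype.sum_prod_type]
  simp only [Fintype.sum_prod_type]
  refine Finset.sum_congr rfl fun I _ => Finset.sum_congr rfl fun J _ =>
    Finset.sum_congr rfl fun K _ => Finset.sum_congr rfl fun L _ => ?_
  rw [scalarProduct_monomial, ← quadNorm_eq]
  split_ifs
  · have hc : starRingEnd ℂ (quadCoeff σ K L) = quadCoeff σ K L := by
      simp [quadCoeff, apply_ite]
    simp only [ofHol, conj, map_mul, rename_X, smul_eq_C_mul, map_C, map_X, hc,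
      rename_C, Sum.swap_inl, nsmul_eq_mul, map_natCast]
    ring
  · rw [zero_smul]

/-- The word `⨂ j, pm (σ j)`. -/
def pmWord (σ : Idx k) : (Fin k → Site) → ℂ := fun γ => ∏ j, pm (σ j) (γ j)

/-- Dualizing the last two vectors turns the symmetric invariant into minus the permanent, and the
antisymmetric one into the product of two symplectic values. This matches words with the norms of
the `B_d`. -/
theorem pm_mul_signs (x : Fin 2) (α : Site) : pm x α * ![1, -1] (α 2) * ![1, -1] (α 3) =
    ![-1, 1] x * (siteNorm x (α 0) (α 1) (α 2).rev (α 3).rev : ℂ) := by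
  have d : ∀ (x : Fin 2) (α : Site), pmInt x α * ![1, -1] (α 2) * ![1, -1] (α 3) =
      ![-1, 1] x * siteNorm x (α 0) (α 1) (α 2).rev (α 3).rev := by decide
  have h1 : ∀ y : Fin 2, (![1, -1] y : ℂ) = ((![1, -1] y : ℤ) : ℂ) := fun y => by
    fin_cases y <;> simp
  have h2 : ∀ y : Fin 2, (![-1, 1] y : ℂ) = ((![-1, 1] y : ℤ) : ℂ) := fun y => by
    fin_cases y <;> simp
  rw [h1, h1, h2, pm]
  exact_mod_cast d x α

theorem formPoly_pmWord (σ : Idx k) : formPoly (sortedType 2) (pmWord σ) =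
    (∏ j, ![-1, 1] (σ j) : ℂ) •
      scalarProduct (quadCovariant (wordDegree σ)) (quadCovariant (wordDegree σ)) := by
  -- The reversal in slots 2 and 3 absorbs the flip of indices in `dualVec`.
  let e : (Fin k → Site) ≃ Idx k × Idx k × Idx k × Idx k :=
    { toFun := fun γ => (fun j => γ j 0, fun j => γ j 1, fun j => (γ j 2).rev,
        fun j => (γ j 3).rev)
      invFun := fun p j => ![p.1 j, p.2.1 j, (p.2.2.1 j).rev, (p.2.2.2 j).rev]
      left_inv := fun γ => by
        funext j r
        fin_cases r <;> simp
      right_inv := fun p => by simp }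
  rw [scalarProduct_quadCovariant]
  refine Eq.trans (b := ∑ p : Idx k × Idx k × Idx k × Idx k, (∏ j, ![-1, 1] (σ j) : ℂ) •
    (∏ i, (siteNorm (σ i) (p.1 i) (p.2.1 i) (p.2.2.1 i) (p.2.2.2 i) : ℂ)) •
      (X (Sum.inl p.1) * X (Sum.inl p.2.1) * X (Sum.inr p.2.2.1) * X (Sum.inr p.2.2.2) :
        MixedPoly k)) ?_ (by simp only [Fintype.sum_prod_type, Finset.smul_sum])
  refine Fintype.sum_equiv e _ _ fun γ => ?_
  have h : pmWord σ γ * sgnIdx (fun j => γ j 2) * sgnIdx (fun j => γ j 3) =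
      (∏ j, ![-1, 1] (σ j) : ℂ) *
        ∏ i, (siteNorm (σ i) (γ i 0) (γ i 1) (γ i 2).rev (γ i 3).rev : ℂ) := by
    simp only [pmWord, sgnIdx, ← Finset.prod_mul_distrib, pm_mul_signs]
  rw [smul_smul]
  change _ = ((∏ j, ![-1, 1] (σ j) : ℂ) *
        ∏ i, (siteNorm (σ i) (γ i 0) (γ i 1) (γ i 2).rev (γ i 3).rev : ℂ)) •
      (X (Sum.inl fun j => γ j 0) * X (Sum.inl fun j => γ j 1) *
        X (Sum.inr (flipIdx fun j => γ j 2)) * X (Sum.inr (flipIdx fun j => γ j 3)) : MixedPoly k)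
  rw [← h, Fin.prod_univ_four]
  simp only [smul_eq_C_mul, twistedVar, sortedType, map_mul]
  simp [dualVec, smul_eq_C_mul]
  ring

/-- The first two arguments are both `a`, while exchanging them multiplies the word by `-1` for each
antisymmetric letter. -/
theorem formPoly_pmWord_eq_zero {σ : Idx k}
    (hσ : ¬Even (Finset.univ.filter fun j => σ j = 1).card) :
    formPoly (sortedType 2) (pmWord σ) = 0 := by
  have h1 : permTensor (Equiv.swap 0 1) (pmWord σ) = (-1 : ℂ) • pmWord σ := by
    funext γ
    simp only [permTensor, pmWord, pm_comp_swap, Finset.prod_mul_distrib, Pi.smul_apply,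
      smul_eq_mul]
    congr 1
    have h2 : ∀ x : Fin 2, (![1, -1] x : ℂ) = if x = 1 then -1 else 1 := fun x => by
      fin_cases x <;> simp
    simp_rw [h2, Finset.prod_ite, Finset.prod_const, one_pow, mul_one]
    exact (Nat.not_even_iff_odd.1 hσ).neg_one_pow
  have h2 := formPoly_permTensor (Equiv.swap 0 1) (sortedType 2) (pmWord σ)
  rw [show sortedType 2 ∘ (Equiv.swap 0 1 : Equiv.Perm (Fin 4)) = sortedType 2 by decide, h1,
    formPoly, tensorForm_smul, ← formPoly, neg_one_smul] at h2
  exact self_eq_neg.1 h2.symm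

theorem wordDegree_mem_evenTuples {σ : Idx k} :
    wordDegree σ ∈ evenTuples k ↔ Even (Finset.univ.filter fun j => σ j = 1).card := by
  have h1 : ∀ j, wordDegree σ j = 0 ∨ wordDegree σ j = 2 := fun j => by
    rw [wordDegree]
    split_ifs <;> simp
  have h2 : ∀ j, wordDegree σ j = 0 ↔ σ j = 1 := fun j => by
    rw [wordDegree]
    generalize σ j = x
    fin_cases x <;> simp
  rw [← Finset.filter_congr fun j _ => h2 j]
  exact and_iff_right h1

theorem exists_wordDegree_eq {d : Fin k → ℕ} (hd : d ∈ evenTuples k) :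
    ∃ σ : Idx k, wordDegree σ = d := by
  refine ⟨fun j => if d j = 2 then 0 else 1, funext fun j => ?_⟩
  rw [wordDegree]
  obtain h | h := hd.1 j <;> simp [h]

theorem scalarProduct_quadCovariant_eq (σ : Idx k) :
    scalarProduct (quadCovariant (wordDegree σ)) (quadCovariant (wordDegree σ)) =
      (∏ j, ![-1, 1] (σ j) : ℂ) • formPoly (sortedType 2) (pmWord σ) := by
  rw [formPoly_pmWord, smul_smul, ← Finset.prod_mul_distrib, Finset.prod_eq_one, one_smul]
  intro j _
  generalize σ j = x
  fin_cases x <;> simp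

theorem pmWord_mem_sliceSpace (σ : Idx k) : pmWord σ ∈ sliceSpace k := by
  classical
  refine ⟨Pi.single σ 1, funext fun γ => ?_⟩
  simp [wordTensor_apply, Pi.single_apply, pmWord]

theorem formPoly_two_mem_span {t : (Fin k → Site) → ℂ} (ht : t ∈ sliceSpace k) :
    formPoly (sortedType 2) t ∈ Submodule.span ℂ
      ((fun d => scalarProduct (quadCovariant d) (quadCovariant d)) '' evenTuples k) := by
  obtain ⟨s, rfl⟩ := ht
  have h1 : wordTensor pm s = ∑ σ, s σ • pmWord σ := by
    funext γ
    simp [wordTensor_apply, pmWord]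
  let F : ((Fin k → Site) → ℂ) →ₗ[ℂ] MixedPoly k :=
    { toFun := formPoly (sortedType 2)
      map_add' := fun _ _ => tensorForm_add _ _ _
      map_smul' := fun _ _ => tensorForm_smul _ _ _ }
  change F _ ∈ _
  rw [h1, map_sum]
  refine Submodule.sum_mem _ fun σ _ => ?_
  rw [map_smul]
  refine Submodule.smul_mem _ _ ?_
  change formPoly (sortedType 2) (pmWord σ) ∈ _
  by_cases hσ : Even (Finset.univ.filter fun j => σ j = 1).card
  · rw [formPoly_pmWord]
    exact Submodule.smul_mem _ _ (Submodule.subset_span ⟨_, wordDegree_mem_evenTuples.2 hσ, rfl⟩)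
  · rw [formPoly_pmWord_eq_zero hσ]
    exact zero_mem _

end QuadCovariant

/-! ### Bidegrees -/

section Bidegree

variable {k : ℕ}

theorem HasBidegree.sum {ι : Type*} {s : Finset ι} {P : ι → MixedPoly k} {p q : ℕ}
    (h : ∀ i ∈ s, HasBidegree (P i) p q) : HasBidegree (∑ i ∈ s, P i) p q :=
  (weightedHomogeneousSubmodule ℂ (bidegreeWeight k) (p, q)).sum_mem h

theorem HasBidegree.smul {P : MixedPoly k} {p q : ℕ} (h : HasBidegree P p q) (c : ℂ) :
    HasBidegree (c • P) p q :=
  (weightedHomogeneousSubmodule ℂ (bidegreeWeight k) (p, q)).smul_mem c h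

theorem hasBidegree_formPoly (q : Fin 5) (t : (Fin k → Site) → ℂ) :
    HasBidegree (formPoly (sortedType q) t) (4 - q) q := by
  have d : ∀ q : Fin 5, ∑ r, (if sortedType q r = 0 then ((1, 0) : ℕ × ℕ) else (0, 1)) =
      (4 - (q : ℕ), (q : ℕ)) := by decide
  refine HasBidegree.sum fun γ _ => HasBidegree.smul ?_ _
  rw [HasBidegree, ← d]
  refine IsWeightedHomogeneous.prod _ _ _ fun r _ => ?_
  simp only [twistedVar]
  split_ifs
  · exact isWeightedHomogeneous_X ℂ (bidegreeWeight k) (Sum.inl _)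
  · exact HasBidegree.smul (p := 0) (q := 1)
      (isWeightedHomogeneous_X ℂ (bidegreeWeight k) (Sum.inr _)) _

theorem hasBidegree_ofHol {P : HolPoly k} {n : ℕ} (hP : P.IsHomogeneous n) :
    HasBidegree (ofHol P) n 0 := by
  intro d hd
  obtain ⟨u, rfl, hu⟩ := coeff_rename_ne_zero _ _ _ hd
  have h := hP hu
  rw [Finsupp.weight_apply, Finsupp.sum] at h
  rw [Finsupp.weight_apply, Finsupp.sum_mapDomain_index (by simp) (by simp [add_mul]),
    Finsupp.sum]
  ext
  · simpa [Prod.fst_sum, bidegreeWeight] using h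
  · simp [Prod.snd_sum, bidegreeWeight]

theorem HasBidegree.conj {P : MixedPoly k} {p q : ℕ} (hP : HasBidegree P p q) :
    HasBidegree (conj P) q p := by
  intro d hd
  obtain ⟨u, rfl, hu⟩ := coeff_rename_ne_zero _ _ _ hd
  rw [coeff_map] at hu
  have h := hP (fun h0 => hu (by rw [h0, map_zero]))
  rw [Finsupp.weight_apply, Finsupp.sum] at h
  rw [Finsupp.weight_apply, Finsupp.sum_mapDomain_index (by simp) (by simp [add_mul]),
    Finsupp.sum]
  have e : ∀ v, bidegreeWeight k (Sum.swap v) = Prod.swap (bidegreeWeight k v) := fun v => by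
    rcases v with I | I <;> rfl
  have h1 := congrArg Prod.fst h
  have h2 := congrArg Prod.snd h
  rw [Prod.fst_sum] at h1
  rw [Prod.snd_sum] at h2
  ext
  · rw [Prod.fst_sum]
    simpa [e] using h2
  · rw [Prod.snd_sum]
    simpa [e] using h1

theorem hasBidegree_scalarProduct_groundForm {Φ : FormPoly k}
    (hΦ : Φ ∈ covariants k 3 fun _ => 1) : HasBidegree (scalarProduct Φ (groundForm k)) 3 1 := by
  obtain ⟨c, hc, rfl⟩ := exists_eq_linForm hΦ
  rw [scalarProduct_linForm_groundForm]
  exact HasBidegree.sum fun J _ => (hasBidegree_ofHol (hc J)).mul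
    (isWeightedHomogeneous_X ℂ (bidegreeWeight k) (Sum.inr J))

theorem hasBidegree_quadCovariant {d : Fin k → ℕ} (hd : d ∈ evenTuples k) :
    HasBidegree (scalarProduct (quadCovariant d) (quadCovariant d)) 2 2 := by
  obtain ⟨σ, rfl⟩ := exists_wordDegree_eq hd
  rw [scalarProduct_quadCovariant_eq]
  exact (hasBidegree_formPoly 2 _).smul _

/-! ### The span of the invariants -/

/-- The five sorted types have distinct bidegrees, so extracting one bidegree leaves a single form.
-/
theorem exists_formPoly_eq {P : MixedPoly k} (hP : P ∈ lsutInvariants k 4) {q : Fin 5}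
    (hq : HasBidegree P (4 - q) q) : ∃ t ∈ sliceSpace k, P = formPoly (sortedType q) t := by
  classical
  rw [← range_sumFormPoly] at hP
  obtain ⟨t, rfl⟩ := hP
  refine ⟨(t q).1, (t q).2.1, ?_⟩
  rw [← weightedHomogeneousComponent_eq_self hq]
  change weightedHomogeneousComponent _ _ (∑ p, formPoly (sortedType p) (t p).1) = _
  rw [map_sum, Finset.sum_eq_single q]
  · exact weightedHomogeneousComponent_eq_self (hasBidegree_formPoly q _)
  · intro p _ hp
    refine (hasBidegree_formPoly p _).weightedHomogeneousComponent_ne _ fun h => hp ?_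
    exact Fin.ext (Prod.ext_iff.1 h).2.symm
  · simp

theorem conj_mem_lsutInvariants {n : ℕ} {P : MixedPoly k} (hP : P ∈ lsutInvariants k n) :
    conj P ∈ lsutInvariants k n := by
  refine ⟨?_, fun g a => ?_⟩
  · refine IsHomogeneous.rename_isHomogeneous ?_
    exact hP.1.map _
  · rw [evalConj_conj, evalConj_conj, hP.2]

theorem mem_of_basis {R ι M M' : Type*} [CommRing R] {φ : R →+* R} [AddCommGroup M] [Module R M]
    [AddCommGroup M'] [Module R M'] {N : Submodule R M} (b : Module.Basis ι R N) (F : M →ₛₗ[φ] M')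
    {S : Submodule R M'} (h : ∀ i, F (b i) ∈ S) {x : M} (hx : x ∈ N) : F x ∈ S := by
  have h1 : (⟨x, hx⟩ : N) ∈ (⊤ : Submodule R N) := trivial
  rw [← b.span_eq] at h1
  refine Submodule.span_induction (p := fun y _ => F y.1 ∈ S) ?_ ?_ ?_ ?_ h1
  · rintro _ ⟨i, rfl⟩
    exact h i
  · simp
  · intro y z _ _ hy hz
    rw [Submodule.coe_add, map_add]
    exact add_mem hy hz
  · intro c y _ hy
    rw [Submodule.coe_smul, map_smulₛₗ]
    exact S.smul_mem _ hy

/-- `ofHol` as a linear map. -/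
def ofHolLin (k : ℕ) : HolPoly k →ₗ[ℂ] MixedPoly k := (rename Sum.inl).toLinearMap

/-- The scalar product with the ground form as a linear map. -/
def groundProduct (k : ℕ) : FormPoly k →ₗ[ℂ] MixedPoly k where
  toFun Φ := scalarProduct Φ (groundForm k)
  map_add' Φ Ψ := scalarProduct_add_left Φ Ψ _
  map_smul' c Φ := scalarProduct_smul_left c Φ _

/-- `conj` as a semilinear map. -/
def conjLin (k : ℕ) : MixedPoly k →ₛₗ[starRingEnd ℂ] MixedPoly k where
  toFun := conj
  map_add' := conj_add
  map_smul' := conj_smul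

theorem lsutInvariants_eq_span {ιC ιD : Type*} (C : Module.Basis ιC ℂ (covariants k 3 fun _ => 1))
    (D : Module.Basis ιD ℂ (sloccInvariants k 4)) :
    lsutInvariants k 4 = Submodule.span ℂ
      (Set.range (fun i => ofHol (D i : HolPoly k)) ∪
       Set.range (fun i => scalarProduct (C i : FormPoly k) (groundForm k)) ∪
       (fun d => scalarProduct (quadCovariant d) (quadCovariant d)) '' evenTuples k ∪
       Set.range (fun i => conj (scalarProduct (C i : FormPoly k) (groundForm k))) ∪
       Set.range (fun i => conj (ofHol (D i : HolPoly k)))) := by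
  apply le_antisymm
  · intro P hP
    rw [← range_sumFormPoly] at hP
    obtain ⟨t, rfl⟩ := hP
    change ∑ q, formPoly (sortedType q) (t q).1 ∈ _
    refine Submodule.sum_mem _ fun q _ => ?_
    have ht := (t q).2.1
    generalize (t q).1 = t at ht ⊢
    have hmem := formPoly_mem_lsutInvariants (sortedType q) ht
    have hconj : HasBidegree (conj (formPoly (sortedType q) t)) q (4 - q) :=
      (hasBidegree_formPoly q t).conj
    fin_cases q
    · obtain ⟨P, hP, h⟩ := exists_ofHol_eq ht
      change formPoly (sortedType 0) t ∈ _
      rw [← h]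
      exact mem_of_basis D (ofHolLin k) (fun i => Submodule.subset_span (by
        exact .inl (.inl (.inl (.inl ⟨i, rfl⟩))))) hP
    · obtain ⟨Φ, hΦ, h⟩ := exists_scalarProduct_eq ht
      change formPoly (sortedType 1) t ∈ _
      rw [← h]
      exact mem_of_basis C (groundProduct k) (fun i => Submodule.subset_span (by
        exact .inl (.inl (.inl (.inr ⟨i, rfl⟩))))) hΦ
    · refine Submodule.span_mono ?_ (formPoly_two_mem_span ht)
      exact fun x hx => .inl (.inl (.inr hx))
    -- Conjugation lands in bidegree `(3, 1)`, where the case `q = 1` applies; conjugating back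
    -- gives the claim. The case `q = 4` reduces to `q = 0` likewise.
    · obtain ⟨t', ht', h'⟩ := exists_formPoly_eq (conj_mem_lsutInvariants hmem) (q := 1) hconj
      obtain ⟨Φ, hΦ, h⟩ := exists_scalarProduct_eq ht'
      rw [← conj_conj (formPoly _ t), h', ← h]
      exact mem_of_basis C ((conjLin k).comp (groundProduct k)) (fun i => Submodule.subset_span (by
        exact .inl (.inr ⟨i, rfl⟩))) hΦ
    · obtain ⟨t', ht', h'⟩ := exists_formPoly_eq (conj_mem_lsutInvariants hmem) (q := 0) hconj
      obtain ⟨P, hP, h⟩ := exists_ofHol_eq ht'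
      rw [← conj_conj (formPoly _ t), h', ← h]
      exact mem_of_basis D ((conjLin k).comp (ofHolLin k)) (fun i => Submodule.subset_span (by
        exact .inr ⟨i, rfl⟩)) hP
  · rw [Submodule.span_le]
    rintro _ ((((⟨i, rfl⟩ | ⟨i, rfl⟩) | ⟨d, hd, rfl⟩) | ⟨i, rfl⟩) | ⟨i, rfl⟩)
    · exact ofHol_mem_lsutInvariants (D i).2
    · exact scalarProduct_groundForm_mem_lsutInvariants (C i).2
    · obtain ⟨σ, rfl⟩ := exists_wordDegree_eq hd
      simp only [scalarProduct_quadCovariant_eq]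
      exact Submodule.smul_mem _ _ (formPoly_mem_lsutInvariants _ (pmWord_mem_sliceSpace σ))
    · exact conj_mem_lsutInvariants (scalarProduct_groundForm_mem_lsutInvariants (C i).2)
    · exact conj_mem_lsutInvariants (ofHol_mem_lsutInvariants (D i).2)

end Bidegree

end Qubit

end

theorem mainTheorem3 (k : ℕ) (hk : 1 ≤ k) {ιC ιD : Type*}
    (C : Module.Basis ιC ℂ (Qubit.covariants k 3 (fun _ => 1)))
    (D : Module.Basis ιD ℂ (Qubit.sloccInvariants k 4)) :
    (Module.finrank ℂ (Qubit.lsutInvariants k 4) : ℚ) =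
        7 / 3 * 2 ^ (k - 1) - 4 / 3 * (-1) ^ (k - 1) ∧
    Qubit.lsutInvariants k 4 = Submodule.span ℂ
      (Set.range (fun i => Qubit.ofHol (D i : Qubit.HolPoly k)) ∪
       Set.range (fun i => Qubit.scalarProduct (C i : Qubit.FormPoly k) (Qubit.groundForm k)) ∪
       (fun d => Qubit.scalarProduct (Qubit.quadCovariant d) (Qubit.quadCovariant d)) ''
         Qubit.evenTuples k ∪
       Set.range (fun i =>
         Qubit.conj (Qubit.scalarProduct (C i : Qubit.FormPoly k) (Qubit.groundForm k))) ∪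
       Set.range (fun i => Qubit.conj (Qubit.ofHol (D i : Qubit.HolPoly k)))) ∧
    (∀ i, Qubit.HasBidegree (Qubit.ofHol (D i : Qubit.HolPoly k)) 4 0) ∧
    (∀ i, Qubit.HasBidegree
      (Qubit.scalarProduct (C i : Qubit.FormPoly k) (Qubit.groundForm k)) 3 1) ∧
    (∀ d ∈ Qubit.evenTuples k, Qubit.HasBidegree
      (Qubit.scalarProduct (Qubit.quadCovariant d) (Qubit.quadCovariant d)) 2 2) ∧
    (∀ i, Qubit.HasBidegree
      (Qubit.conj (Qubit.scalarProduct (C i : Qubit.FormPoly k) (Qubit.groundForm k))) 1 3) ∧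
    (∀ i, Qubit.HasBidegree (Qubit.conj (Qubit.ofHol (D i : Qubit.HolPoly k))) 0 4) := by
  obtain ⟨n, rfl⟩ := Nat.exists_eq_add_of_le' hk
  refine ⟨?_, Qubit.lsutInvariants_eq_span C D, fun i => Qubit.hasBidegree_ofHol (D i).2.1,
    fun i => Qubit.hasBidegree_scalarProduct_groundForm (C i).2,
    fun d hd => Qubit.hasBidegree_quadCovariant hd,
    fun i => (Qubit.hasBidegree_scalarProduct_groundForm (C i).2).conj,
    fun i => (Qubit.hasBidegree_ofHol (D i).2.1).conj⟩
  rw [Qubit.finrank_lsutInvariants, Nat.add_sub_cancel]
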